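/- Let $P$ be a convex polygon with $n\ge 3$ vertices $v_1,\dots,v_n$ in clockwise order, no three of them collinear; indices are taken modulo $n$. Let $e_i$ be the edge from $v_i$ to $v_{i+1}$, regarded as a directed segment without its endpoints. The vertices and edges are the *units* of $P$; the clockwise next unit of $v_i$ is $e_i$ and that of $e_i$ is $v_{i+1}$. Put $\mathsf{TermEnd}(v_i)=v_i$ and $\mathsf{TermEnd}(e_i)=v_{i+1}$. A triangle $\triangle ABC$ always has its corners on $\partial P$ and listed clockwise, so that $A$ lies on the right of $\overrightarrow{BC}$. Corner $A$ is *stable* if it has the largest distance to the line $BC$ among all points of $P$ on the right of $\overrightarrow{BC}$; similarly for $B$ (with $\overrightarrow{CA}$) and $C$ (with $\overrightarrow{AB}$). The triangle is *3-stable* if its corners are stable and are vertices of $P$. For $j\ne k$ let $r_1,r_2$ be the rays from $v_j$ in the directions of $e_{k-1},e_k$, and let $r_1',r_2'$ be the rays from $v_k$ in the directions opposite to $e_{j-1},e_j$. Let $H_{j,k}=r_1\cap r_1'$, $I_{j,k}=r_2\cap r_2'$, $J_{j,k}=r_1\cap r_2'$, $K_{j,k}=r_2\cap r_1'$; a point is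 $\infty$, with infinite distance to the line $v_jv_k$, if the two rays do not meet (and if they overlap in a segment, which then lies on that line, the distance is $0$). Let $Q_{j,k}$ be the intersection of the closed sector at $v_j$ bounded by $r_1,r_2$ with the closed sector at $v_k$ bounded by $r_1',r_2'$. A triangle with stable corners is *generally 3-stable* if it does not have exactly two corners at vertices, or if it has exactly two, say $v_j,v_k$ with the third corner $A\in e_i$ and $A,v_j,v_k$ clockwise, and $A$ is an endpoint of the segment in which $Q_{j,k}$ meets the closed side $v_iv_{i+1}$. A pair of units $(u_1,u_2)$ is *G-dead* if there is no generally 3-stable $\triangle ABC$ with $B\in u_1$ and $C\in u_2$. Let $\triangle v_rv_sv_t$ be 3-stable and let $$\mathcal U(r,s,t)=\{v_s,e_s,v_{s+1},\dots,e_{t-1},v_t\}\times\{v_t,e_t,v_{t+1},\dots,e_{r-1},v_r\},$$ viewed as a table whose rows, from top to bottom, and columns, from left to right, are indexed by the two lists in the order shown. Consider the following process. Start with $(u_1,u_2)=(v_s,v_t)$ and $A=v_r$. Repeat until $(u_1,u_2)=(v_t,v_r)$: let $v_j=\mathsf{TermEnd}(u_1)$, $v_k=\mathsf{TermEnd}(u_2)$;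 while the clockwise next vertex of $A$ is strictly farther than $A$ from the line $v_jv_k$, replace $A$ by that next vertex; then, comparing distances to the line $v_jv_k$, advance ("kill") $u_1$ to its next unit if - $(u_1,u_2)=(v_j,v_k)$ and $A\le I_{j,k}$, or - $(u_1,u_2)=(e_{j-1},e_{k-1})$ and $A\le H_{j,k}$, or - $(u_1,u_2)=(v_j,e_{k-1})$ and $A<J_{j,k}$, or - $(u_1,u_2)=(e_{j-1},v_k)$ and $A\le K_{j,k}$, and otherwise advance ("kill") $u_2$ to its next unit. Then: 1. Whenever $u_1$ is about to be killed, all vertex pairs and edge pairs to the right of $(u_1,u_2)$ in its row of the table are G-dead. Whenever $u_2$ is about to be killed, all vertex pairs and edge pairs below $(u_1,u_2)$ in its column are G-dead. 2. Throughout the process, $(u_1,u_2)\in\mathcal U(r,s,t)$, $(u_1,u_2)\ne(v_t,v_t)$ and $(u_1,u_2)\ne(e_{t-1},v_t)$, and the process terminates, at $(u_1,u_2)=(v_t,v_r)$. 3. Consequently, every vertex pair and every edge pair in $\mathcal U(r,s,t)$ that is not G-dead is visited, i.e. is the value of $(u_1,u_2)$ at some moment of the process. -/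

import Mathlib

noncomputable section

namespace RotateKill

/-- The Euclidean plane. -/
abbrev Plane : Type := EuclideanSpace ℝ (Fin 2)

/-- The two-dimensional cross product. -/
def cross (x y : Plane) : ℝ := x 0 * y 1 - x 1 * y 0

/-- `X` lies (strictly) on the right of the directed line from `B` to `C`. -/
def RightOf (B C X : Plane) : Prop := cross (C - B) (X - B) < 0

/-- The distance from `X` to the line through `B` and `C`. -/
def lineDist (B C X : Plane) : ℝ :=
  Metric.infDist X ((affineSpan ℝ {B, C} : AffineSubspace ℝ Plane) : Set Plane)

/-- `v` is a clockwise enumeration, with indices modulo `n`, of the vertices of a convex polygon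
with `n ≥ 3` vertices, no three of which are collinear: every vertex other than the two endpoints
of the directed edge from `v i` to `v (i + 1)` lies strictly on the right of that edge. -/
structure IsClockwiseConvexPolygon {n : ℕ} (v : ZMod n → Plane) : Prop where
  three_le : 3 ≤ n
  rightOf : ∀ i j : ZMod n, j ≠ i → j ≠ i + 1 → RightOf (v i) (v (i + 1)) (v j)

/-- The polygon as a closed region. -/
def polygon {n : ℕ} (v : ZMod n → Plane) : Set Plane := convexHull ℝ (Set.range v)

/-- The boundary of the polygon: the union of its closed sides. -/
def boundary {n : ℕ} (v : ZMod n → Plane) : Set Plane :=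
  ⋃ i : ZMod n, segment ℝ (v i) (v (i + 1))

/-- The units of the polygon: the vertices `v i` and the edges `e i`, where `e i` leads from
`v i` to `v (i + 1)`. -/
inductive PolyUnit (n : ℕ) : Type
  | vertex (i : ZMod n) : PolyUnit n
  | edge (i : ZMod n) : PolyUnit n

namespace PolyUnit

/-- The clockwise next unit. -/
def next {n : ℕ} : PolyUnit n → PolyUnit n
  | vertex i => edge i
  | edge i => vertex (i + 1)

/-- The index of the terminal endpoint of a unit. -/
def termEnd {n : ℕ} : PolyUnit n → ZMod n
  | vertex i => i
  | edge i => i + 1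

/-- The points of a unit; edges do not contain their endpoints. -/
def points {n : ℕ} (v : ZMod n → Plane) : PolyUnit n → Set Plane
  | vertex i => {v i}
  | edge i => openSegment ℝ (v i) (v (i + 1))

end PolyUnit

/-- The corner `A` is stable in the triangle `A B C`: it has the largest distance to the line
`B C` among all points of the polygon on the right of the directed line from `B` to `C`. -/
def IsStableCorner {n : ℕ} (v : ZMod n → Plane) (A B C : Plane) : Prop :=
  ∀ X ∈ polygon v, RightOf B C X → lineDist B C X ≤ lineDist B C A

/-- `A`, `B`, `C` are the corners, in clockwise order, of a triangle inscribed in the boundary of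
the polygon, and all three corners are stable. -/
structure IsStableTriangle {n : ℕ} (v : ZMod n → Plane) (A B C : Plane) : Prop where
  mem_A : A ∈ boundary v
  mem_B : B ∈ boundary v
  mem_C : C ∈ boundary v
  clockwise : RightOf B C A
  stable_A : IsStableCorner v A B C
  stable_B : IsStableCorner v B C A
  stable_C : IsStableCorner v C A B

/-- A 3-stable triangle: all corners are stable and are vertices of the polygon. -/
def IsThreeStable {n : ℕ} (v : ZMod n → Plane) (A B C : Plane) : Prop :=
  IsStableTriangle v A B C ∧ A ∈ Set.range v ∧ B ∈ Set.range v ∧ C ∈ Set.range v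

/-- The direction of the edge `e i`. -/
def edgeDir {n : ℕ} (v : ZMod n → Plane) (i : ZMod n) : Plane := v (i + 1) - v i

/-- The closed ray from `p` in direction `d`. -/
def ray (p d : Plane) : Set Plane := {X | ∃ a : ℝ, 0 ≤ a ∧ X = p + a • d}

/-- The closed sector at `p` bounded by the rays in the directions `d` and `d'`. -/
def sector (p d d' : Plane) : Set Plane :=
  {X | ∃ a b : ℝ, 0 ≤ a ∧ 0 ≤ b ∧ X = p + a • d + b • d'}

/-- The ray `r₁` from `v j` with the direction of `e (k - 1)`. -/
def rayOne {n : ℕ} (v : ZMod n → Plane) (j k : ZMod n) : Set Plane :=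
  ray (v j) (edgeDir v (k - 1))

/-- The ray `r₂` from `v j` with the direction of `e k`. -/
def rayTwo {n : ℕ} (v : ZMod n → Plane) (j k : ZMod n) : Set Plane :=
  ray (v j) (edgeDir v k)

/-- The ray `r₁'` from `v k` opposite to the direction of `e (j - 1)`. -/
def rayOne' {n : ℕ} (v : ZMod n → Plane) (j k : ZMod n) : Set Plane :=
  ray (v k) (-edgeDir v (j - 1))

/-- The ray `r₂'` from `v k` opposite to the direction of `e j`. -/
def rayTwo' {n : ℕ} (v : ZMod n → Plane) (j k : ZMod n) : Set Plane :=
  ray (v k) (-edgeDir v j)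

/-- The region `Q j k` cut out by the four rays: the common part of the sector at `v j` bounded
by `r₁`, `r₂` and the sector at `v k` bounded by `r₁'`, `r₂'`. -/
def regionQ {n : ℕ} (v : ZMod n → Plane) (j k : ZMod n) : Set Plane :=
  sector (v j) (edgeDir v (k - 1)) (edgeDir v k) ∩
    sector (v k) (-edgeDir v (j - 1)) (-edgeDir v j)

/-- The point `H` of the pair `(v j, v k)`, given as the intersection of two rays; the empty set
stands for the point at infinity. -/
def ptH {n : ℕ} (v : ZMod n → Plane) (j k : ZMod n) : Set Plane := rayOne v j k ∩ rayOne' v j k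

/-- The point `I` of the pair `(v j, v k)`, empty if it is at infinity. -/
def ptI {n : ℕ} (v : ZMod n → Plane) (j k : ZMod n) : Set Plane := rayTwo v j k ∩ rayTwo' v j k

/-- The point `J` of the pair `(v j, v k)`, empty if it is at infinity. -/
def ptJ {n : ℕ} (v : ZMod n → Plane) (j k : ZMod n) : Set Plane := rayOne v j k ∩ rayTwo' v j k

/-- The point `K` of the pair `(v j, v k)`, empty if it is at infinity. -/
def ptK {n : ℕ} (v : ZMod n → Plane) (j k : ZMod n) : Set Plane := rayTwo v j k ∩ rayOne' v j k

/-- If `A` lies in an edge `e i` and `B`, `C` are vertices `v j`, `v k`, then `A` is an endpoint of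
the segment in which the closed side `e i` meets `Q j k`. -/
def RepresentativeAt {n : ℕ} (v : ZMod n → Plane) (A B C : Plane) : Prop :=
  ∀ i j k : ZMod n, A ∈ (PolyUnit.edge i).points v → B = v j → C = v k →
    A ∈ Set.extremePoints ℝ (segment ℝ (v i) (v (i + 1)) ∩ regionQ v j k)

/-- Generally 3-stable triangles: all corners are stable and, if exactly two of the corners are
vertices, the triangle is a representative of its equivalence class. -/
def IsGenerallyThreeStable {n : ℕ} (v : ZMod n → Plane) (A B C : Plane) : Prop :=
  IsStableTriangle v A B C ∧
    RepresentativeAt v A B C ∧ RepresentativeAt v B C A ∧ RepresentativeAt v C A B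

/-- The unit pair `(u₁, u₂)` is G-dead. -/
def GDead {n : ℕ} (v : ZMod n → Plane) (u₁ u₂ : PolyUnit n) : Prop :=
  ¬ ∃ A B C : Plane, IsGenerallyThreeStable v A B C ∧ B ∈ u₁.points v ∧ C ∈ u₂.points v

/-- The units `v a, e a, v (a + 1), …, v b`, met when walking clockwise from `v a` to `v b`. -/
def arc {n : ℕ} (a b : ZMod n) : Set (PolyUnit n) :=
  {u | ∃ p : ℕ, p ≤ 2 * (b - a).val ∧ u = PolyUnit.next^[p] (PolyUnit.vertex a)}

/-- `u` comes strictly before `w` in the list `v a, e a, v (a + 1), …, v b`. -/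
def ArcLT {n : ℕ} (a b : ZMod n) (u w : PolyUnit n) : Prop :=
  ∃ p q : ℕ, p < q ∧ q ≤ 2 * (b - a).val ∧
    u = PolyUnit.next^[p] (PolyUnit.vertex a) ∧ w = PolyUnit.next^[q] (PolyUnit.vertex a)

/-- The table `U(r, s, t)` of unit pairs. -/
def table {n : ℕ} (r s t : ZMod n) : Set (PolyUnit n × PolyUnit n) := arc s t ×ˢ arc t r

/-- The pair consists of two vertices or of two edges. -/
def IsVertexOrEdgePair {n : ℕ} : PolyUnit n × PolyUnit n → Prop
  | (.vertex _, .vertex _) => True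
  | (.edge _, .edge _) => True
  | _ => False

/-- The variables of the algorithm: the index of the vertex `A`, and the units `u₁`, `u₂`. -/
structure Config (n : ℕ) : Type where
  A : ZMod n
  u₁ : PolyUnit n
  u₂ : PolyUnit n

/-- The elementary actions of the algorithm. -/
inductive Action : Type
  | advanceA
  | killFst
  | killSnd

/-- The guard of the inner while loop: `A + 1` is farther than `A` from the line `v j v k`,
where `v j`, `v k` are the terminal endpoints of `u₁`, `u₂`. -/
def whileGuard {n : ℕ} (v : ZMod n → Plane) (c : Config n) : Prop :=
  lineDist (v c.u₁.termEnd) (v c.u₂.termEnd) (v c.A) <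
    lineDist (v c.u₁.termEnd) (v c.u₂.termEnd) (v (c.A + 1))

/-- `A ≤ X` in the distance to the line `v j v k`, where `X` is given as a set of points that is
empty if `X = ∞`. (If the set has more than one point, it lies on the line `v j v k`.) -/
def DistLE {n : ℕ} (v : ZMod n → Plane) (j k : ZMod n) (A : Plane) (S : Set Plane) : Prop :=
  ∀ X ∈ S, lineDist (v j) (v k) A ≤ lineDist (v j) (v k) X

/-- `A < X` in the distance to the line `v j v k`, where `X` is given as a set of points that is
empty if `X = ∞`. (If the set has more than one point, it lies on the line `v j v k`.) -/
def DistLT {n : ℕ} (v : ZMod n → Plane) (j k : ZMod n) (A : Plane) (S : Set Plane) : Prop :=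
  ∀ X ∈ S, lineDist (v j) (v k) A < lineDist (v j) (v k) X

/-- The criterion, evaluated after the inner while loop, for advancing `u₁` (otherwise `u₂` is
advanced). With `v j`, `v k` the terminal endpoints of `u₁`, `u₂`, it reads: `A ≤ I j k` for
`(v j, v k)`, `A ≤ H j k` for `(e (j - 1), e (k - 1))`, `A < J j k` for `(v j, e (k - 1))`, and
`A ≤ K j k` for `(e (j - 1), v k)`. -/
def killFstCriterion {n : ℕ} (v : ZMod n → Plane) (c : Config n) : Prop :=
  let j := c.u₁.termEnd
  let k := c.u₂.termEnd
  match c.u₁, c.u₂ with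
  | .vertex _, .vertex _ => DistLE v j k (v c.A) (ptI v j k)
  | .edge _, .edge _ => DistLE v j k (v c.A) (ptH v j k)
  | .vertex _, .edge _ => DistLT v j k (v c.A) (ptJ v j k)
  | .edge _, .vertex _ => DistLE v j k (v c.A) (ptK v j k)

open Classical in
/-- The next elementary action: one more round of the inner while loop if its guard holds, and
otherwise the advance of `u₁` or of `u₂` that ends the current round of the outer loop. -/
def nextAction {n : ℕ} (v : ZMod n → Plane) (c : Config n) : Action :=
  if whileGuard v c then .advanceA
  else if killFstCriterion v c then .killFst
  else .killSnd

/-- One elementary step of the algorithm. -/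
def step {n : ℕ} (v : ZMod n → Plane) (c : Config n) : Config n :=
  match nextAction v c with
  | .advanceA => { c with A := c.A + 1 }
  | .killFst => { c with u₁ := c.u₁.next }
  | .killSnd => { c with u₂ := c.u₂.next }

/-- The configuration after `m` elementary steps, started with `A = v r`, `(u₁, u₂) = (v s, v t)`
(the test for termination is not built in here). -/
def config {n : ℕ} (v : ZMod n → Plane) (r s t : ZMod n) (m : ℕ) : Config n :=
  (step v)^[m] ⟨r, .vertex s, .vertex t⟩

/-- The unit pair `(u₁, u₂)` after `m` elementary steps. -/
def pairAt {n : ℕ} (v : ZMod n → Plane) (r s t : ZMod n) (m : ℕ) : PolyUnit n × PolyUnit n :=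
  ((config v r s t m).u₁, (config v r s t m).u₂)

/-- The algorithm, whose outer loop runs until `(u₁, u₂) = (v t, v r)`, stops after exactly `N`
elementary steps. -/
def StopsAt {n : ℕ} (v : ZMod n → Plane) (r s t : ZMod n) (N : ℕ) : Prop :=
  pairAt v r s t N = (.vertex t, .vertex r) ∧
    ∀ m < N, pairAt v r s t m ≠ (.vertex t, .vertex r)

end RotateKill

end

namespace RotateKill

/-! Let W and K be the terminal ends of u₁ and u₂. Let E be the direction of u₁ if u₁ is an edge,
and of the edge leaving it if u₁ is a vertex; let p be defined in the same way from u₂. In all four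
cases of the criterion, the point compared with A is the intersection I of the ray from W along p
with the ray from K along -E. Stability of a corner says that no point of P lies beyond the parallel
to the opposite side through that corner; this is linear in cross products, and the geometry reduces
to sign computations with Plücker relations.

When the inner loop stops, A has the largest signed height over WK in all of P: the edges that A has
passed never descend with respect to the current chord, and heights along a convex chain are
unimodal (`orient_le_of_peak`).

Suppose u₁ is killed, but a stable triangle XBC has B in u₁ and C later in the row. Stability of B
and C puts X on the far side of both lines through I (`killFst_core`), so X is higher than I (for J:
at least as high). As A is no lower than X, the criterion fails.

Suppose u₂ is killed, so that the rays do meet, but C lies in u₂ and B later in the column. Scale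
the height over each chord so that p has height one. Stability of X bounds A by X, and stability of
B bounds X by I, so that A ≤ I if u₂ is a vertex (`killSnd_vertex_core`) and A < I if it is an edge
(`killSnd_edge_core`). This contradicts the failed criterion. The case J is strict in the criterion
because there the first argument gives only a weak inequality and the second a strict one.

The given triangle, read with apex v_s, keeps the final pair (v_t, v_r) from being dead. Hence
neither unit can be killed at its last position before the other has arrived, and the process stays
in the table. Each step raises one of three bounded offsets, so it ends. A pair passed over without
being visited was to the right of, or below, a killed unit, hence dead. -/

/-! ### Signed areas and distances to lines. -/

/-- The clockwise cross product, which is positive if `y` points to the right of `x`. -/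
noncomputable def cw (x y : Plane) : ℝ := x 1 * y 0 - x 0 * y 1

/-- Twice the signed area of the triangle `a b c`, positive if the triangle is clockwise. -/
noncomputable def orient (a b c : Plane) : ℝ := cw (b - a) (c - a)

theorem rightOf_iff {B C X : Plane} : RightOf B C X ↔ 0 < orient B C X := by
  simp only [RightOf, cross, orient, cw]
  constructor <;> intro h <;> linarith

theorem orient_rotate (a b c : Plane) : orient b c a = orient a b c := by
  simp only [orient, cw, PiLp.sub_apply]
  ring

/-- The Plücker relation. -/
theorem cw_plucker (a b c d : Plane) :
    cw a b * cw c d - cw a c * cw b d + cw a d * cw b c = 0 := by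
  simp only [cw]
  ring

theorem orient_openSegment_pos {a b P y z : Plane} (hP : P ∈ openSegment ℝ a b)
    (ha : 0 ≤ orient a y z) (hb : 0 < orient b y z) : 0 < orient P y z := by
  obtain ⟨α, β, hα, hβ, hαβ, rfl⟩ := hP
  have h : orient (α • a + β • b) y z = α * orient a y z + β * orient b y z := by
    obtain rfl : α = 1 - β := by linarith
    simp only [orient, cw, PiLp.sub_apply, PiLp.add_apply, PiLp.smul_apply, smul_eq_mul]
    ring
  rw [h]
  positivity

theorem orient_openSegment_pos' {a b P y z : Plane} (hP : P ∈ openSegment ℝ a b)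
    (ha : 0 < orient a y z) (hb : 0 ≤ orient b y z) : 0 < orient P y z :=
  orient_openSegment_pos (openSegment_symm ℝ a b ▸ hP) hb ha

theorem orient_openSegment_nonneg {a b P y z : Plane} (hP : P ∈ openSegment ℝ a b)
    (ha : 0 ≤ orient a y z) (hb : 0 ≤ orient b y z) : 0 ≤ orient P y z := by
  obtain ⟨α, β, hα, hβ, hαβ, rfl⟩ := hP
  have h : orient (α • a + β • b) y z = α * orient a y z + β * orient b y z := by
    obtain rfl : α = 1 - β := by linarith
    simp only [orient, cw, PiLp.sub_apply, PiLp.add_apply, PiLp.smul_apply, smul_eq_mul]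
    ring
  rw [h]
  positivity

theorem norm_sq_plane (x : Plane) : ‖x‖ ^ 2 = x 0 ^ 2 + x 1 ^ 2 := by
  rw [EuclideanSpace.norm_sq_eq]
  simp [Fin.sum_univ_two]

theorem abs_cw_le (x y : Plane) : |cw x y| ≤ ‖x‖ * ‖y‖ := by
  apply abs_le_of_sq_le_sq _ (by positivity)
  rw [mul_pow, norm_sq_plane, norm_sq_plane]
  simp only [cw]
  nlinarith [sq_nonneg (x 0 * y 0 + x 1 * y 1)]

/-- The distance to a line in terms of the cross product. -/
theorem lineDist_eq {B C : Plane} (h : B ≠ C) (X : Plane) :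
    lineDist B C X = |orient B C X| / ‖C - B‖ := by
  have hn : 0 < ‖C - B‖ := norm_pos_iff.2 (sub_ne_zero.2 h.symm)
  have hn2 := norm_sq_plane (C - B)
  have hmem : ∀ Y : Plane, Y ∈ (affineSpan ℝ {B, C} : AffineSubspace ℝ Plane) ↔
      ∃ t : ℝ, Y = B + t • (C - B) := by
    intro Y
    obtain ⟨w, rfl⟩ : ∃ w, Y = w +ᵥ B := ⟨Y - B, by simp⟩
    rw [vadd_left_mem_affineSpan_pair]
    constructor
    · rintro ⟨t, h⟩
      exact ⟨t, by rw [← h, vsub_eq_sub, vadd_eq_add, add_comm]⟩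
    · rintro ⟨t, h⟩
      exact ⟨t, by rw [vadd_eq_add, add_comm] at h; rw [vsub_eq_sub, add_left_cancel h]⟩
  apply le_antisymm
  -- `t` is the parameter of the foot of the perpendicular from `X`.
  · set t : ℝ := ((C - B) 0 * (X - B) 0 + (C - B) 1 * (X - B) 1) / ‖C - B‖ ^ 2 with ht
    refine (Metric.infDist_le_dist_of_mem ((hmem _).2 ⟨t, rfl⟩)).trans (le_of_eq ?_)
    rw [dist_eq_norm, eq_div_iff hn.ne']
    have hs : 0 < (C - B) 0 ^ 2 + (C - B) 1 ^ 2 := by rw [← hn2]; positivity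
    refine (sq_eq_sq₀ (by positivity) (abs_nonneg _)).1 ?_
    rw [mul_pow, sq_abs, norm_sq_plane, hn2, ht, hn2, orient, cw]
    simp only [PiLp.sub_apply, PiLp.add_apply, PiLp.smul_apply, smul_eq_mul] at hs ⊢
    field_simp
    ring
  · refine (Metric.le_infDist ⟨B, (hmem B).2 ⟨0, by simp⟩⟩).2 ?_
    intro Y hY
    obtain ⟨t, rfl⟩ := (hmem Y).1 hY
    rw [dist_eq_norm, div_le_iff₀ hn, mul_comm]
    refine le_trans (le_of_eq ?_) (abs_cw_le _ _)
    congr 1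
    simp only [orient, cw, PiLp.sub_apply, PiLp.add_apply, PiLp.smul_apply, smul_eq_mul]
    ring

theorem lineDist_le_iff {B C X Y : Plane} (h : B ≠ C) :
    lineDist B C X ≤ lineDist B C Y ↔ |orient B C X| ≤ |orient B C Y| := by
  rw [lineDist_eq h, lineDist_eq h,
    div_le_div_iff_of_pos_right (norm_pos_iff.2 (sub_ne_zero.2 h.symm))]

theorem lineDist_lt_iff {B C X Y : Plane} (h : B ≠ C) :
    lineDist B C X < lineDist B C Y ↔ |orient B C X| < |orient B C Y| := by
  rw [lineDist_eq h, lineDist_eq h,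
    div_lt_div_iff_of_pos_right (norm_pos_iff.2 (sub_ne_zero.2 h.symm))]

theorem ne_of_orient_pos {B C X : Plane} (h : 0 < orient B C X) : B ≠ C := by
  rintro rfl
  simp [orient, cw] at h

/-! ### Stability as linear inequalities. -/

/-- Stability of all corners, expressed by cross products. -/
structure Stable (P : Set Plane) (A B C : Plane) : Prop where
  mem_A : A ∈ P
  mem_B : B ∈ P
  mem_C : C ∈ P
  pos : 0 < orient B C A
  le_A : ∀ Y ∈ P, cw (C - B) (Y - A) ≤ 0
  le_B : ∀ Y ∈ P, cw (A - C) (Y - B) ≤ 0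
  le_C : ∀ Y ∈ P, cw (B - A) (Y - C) ≤ 0

theorem Stable.rotate {P : Set Plane} {A B C : Plane} (h : Stable P A B C) : Stable P B C A :=
  ⟨h.mem_B, h.mem_C, h.mem_A, by rw [orient_rotate]; exact h.pos, h.le_B, h.le_C, h.le_A⟩

/-- Points not on the right of `BC` have nonpositive signed height, below that of `A`; so the bound
extends to the whole polygon and the absolute values disappear. -/
theorem IsStableCorner.cw_le {n : ℕ} {v : ZMod n → Plane} {A B C : Plane}
    (h : IsStableCorner v A B C) (hp : 0 < orient B C A) :
    ∀ Y ∈ polygon v, cw (C - B) (Y - A) ≤ 0 := by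
  intro Y hY
  have e : cw (C - B) (Y - A) = orient B C Y - orient B C A := by
    simp only [orient, cw, PiLp.sub_apply]; ring
  rw [e]
  by_cases hr : 0 < orient B C Y
  · have h1 := (lineDist_le_iff (ne_of_orient_pos hp)).1 (h Y hY (rightOf_iff.2 hr))
    rw [abs_of_pos hr, abs_of_pos hp] at h1
    linarith
  · linarith

theorem boundary_subset_polygon {n : ℕ} (v : ZMod n → Plane) : boundary v ⊆ polygon v := by
  refine Set.iUnion_subset fun i => (convex_convexHull ℝ _).segment_subset ?_ ?_
  · exact subset_convexHull ℝ _ ⟨i, rfl⟩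
  · exact subset_convexHull ℝ _ ⟨i + 1, rfl⟩

theorem IsStableTriangle.stable {n : ℕ} {v : ZMod n → Plane} {A B C : Plane}
    (h : IsStableTriangle v A B C) : Stable (polygon v) A B C := by
  have hp : 0 < orient B C A := rightOf_iff.1 h.clockwise
  refine ⟨boundary_subset_polygon v h.mem_A, boundary_subset_polygon v h.mem_B,
    boundary_subset_polygon v h.mem_C, hp, h.stable_A.cw_le hp, h.stable_B.cw_le ?_,
    h.stable_C.cw_le ?_⟩
  · rwa [orient_rotate]
  · rwa [← orient_rotate]

theorem polygon_subset_halfPlane {n : ℕ} {v : ZMod n → Plane} {d a : Plane}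
    (h : ∀ i, 0 ≤ cw d (v i - a)) : ∀ Y ∈ polygon v, 0 ≤ cw d (Y - a) := by
  have hc : Convex ℝ {Y : Plane | 0 ≤ cw d (Y - a)} := by
    intro x hx y hy α β hα hβ hαβ
    have e : cw d (α • x + β • y - a) = α * cw d (x - a) + β * cw d (y - a) := by
      obtain rfl : α = 1 - β := by linarith
      simp only [cw, PiLp.sub_apply, PiLp.add_apply, PiLp.smul_apply, smul_eq_mul]
      ring
    simp only [Set.mem_ofPred_eq] at hx hy ⊢
    rw [e]
    positivity
  exact fun Y hY => convexHull_min (by rintro _ ⟨i, rfl⟩; exact h i) hc hY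

/-! ### Convex position of the vertices. -/

/-- The vertices met when walking clockwise from `v s`. -/
def walk {n : ℕ} (v : ZMod n → Plane) (s : ZMod n) (i : ℕ) : Plane := v (s + (i : ZMod n))

theorem walk_add_period {n : ℕ} (v : ZMod n → Plane) (s : ZMod n) (i : ℕ) :
    walk v s (i + n) = walk v s i := by
  simp [walk]

/-- The hypothesis on the edges covers triangles containing the first edge of the fan or two
consecutive outer vertices. The Plücker relation for the vectors from `v a` to the vertices 1, `l`,
`m`, `m + 1` gives the induction step. -/
theorem orient_fan_pos {n : ℕ} {v : ZMod n → Plane} (hv : IsClockwiseConvexPolygon v)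
    (a : ZMod n) {l m : ℕ} (hl : 0 < l) (hlm : l < m) (hm : m < n) :
    0 < orient (v a) (walk v a l) (walk v a m) := by
  have cast_ne : ∀ {p q : ℕ}, p < n → q < n → p ≠ q → a + (p : ZMod n) ≠ a + (q : ZMod n) := by
    intro p q hp hq hpq h
    have h' := (ZMod.natCast_eq_natCast_iff' p q n).1 (add_left_cancel h)
    rw [Nat.mod_eq_of_lt hp, Nat.mod_eq_of_lt hq] at h'
    exact hpq h'
  have first : ∀ {m : ℕ}, 1 < m → m < n → 0 < orient (v a) (walk v a 1) (walk v a m) := by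
    intro m h1 h2
    have := rightOf_iff.1 (hv.rightOf a (a + (m : ZMod n)) ?_ ?_)
    · simpa [walk] using this
    · have := cast_ne h2 (by omega : 0 < n) (by omega)
      simpa using this
    · have := cast_ne h2 (by omega : 1 < n) (by omega)
      simpa using this
  have consec : ∀ {m : ℕ}, 0 < m → m + 1 < n →
      0 < orient (v a) (walk v a m) (walk v a (m + 1)) := by
    intro m h1 h2
    have h := rightOf_iff.1 (hv.rightOf (a + (m : ZMod n)) a ?_ ?_)
    · rw [orient_rotate] at h
      simpa [walk, add_assoc] using h
    · have := cast_ne (by omega : 0 < n) (by omega : m < n) (by omega)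
      simpa using this
    · have := cast_ne (by omega : 0 < n) (by omega : m + 1 < n) (by omega)
      simpa [add_assoc] using this
  induction m with
  | zero => omega
  | succ m ih =>
    rcases Nat.lt_or_ge l m with h | h
    · rcases Nat.lt_or_ge 1 l with h1 | h1
      · have i1 := ih h (by omega)
        have i2 := consec (by omega : 0 < m) hm
        have i3 := first h1 (by omega)
        have i4 := first (by omega : 1 < m) (by omega)
        have i5 := first (by omega : 1 < m + 1) hm
        have pl := cw_plucker (walk v a 1 - v a) (walk v a l - v a) (walk v a m - v a)
          (walk v a (m + 1) - v a)
        simp only [orient] at *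
        have := mul_pos i3 i2
        have := mul_pos i5 i1
        exact pos_of_mul_pos_right (b := _)
          (by linarith : 0 < cw (walk v a 1 - v a) (walk v a m - v a) *
            cw (walk v a l - v a) (walk v a (m + 1) - v a)) i4.le
      · obtain rfl : l = 1 := by omega
        exact first hlm hm
    · obtain rfl : l = m := by omega
      exact consec hl hm

/-- Three vertices in clockwise order form a clockwise triangle. -/
theorem orient_walk_pos {n : ℕ} {v : ZMod n → Plane} (hv : IsClockwiseConvexPolygon v)
    (s : ZMod n) {i j k : ℕ} (hij : i < j) (hjk : j < k) (hk : k < i + n) :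
    0 < orient (walk v s i) (walk v s j) (walk v s k) := by
  have h := orient_fan_pos hv (s + (i : ZMod n)) (l := j - i) (m := k - i) (by omega) (by omega)
    (by omega)
  have e : ∀ {m : ℕ}, i ≤ m → walk v (s + (i : ZMod n)) (m - i) = walk v s m := by
    intro m hm
    simp only [walk]
    rw [Nat.cast_sub hm]
    congr 1
    ring
  rwa [e hij.le, e (hij.trans hjk).le] at h

theorem orient_walk_nonneg {n : ℕ} {v : ZMod n → Plane} (hv : IsClockwiseConvexPolygon v)
    (s : ZMod n) {i j k : ℕ} (hij : i ≤ j) (hjk : j ≤ k) (hk : k ≤ i + n) :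
    0 ≤ orient (walk v s i) (walk v s j) (walk v s k) := by
  rcases hij.eq_or_lt with rfl | hij
  · simp [orient, cw]
  rcases hjk.eq_or_lt with rfl | hjk
  · simp only [orient, cw]; linarith
  rcases hk.eq_or_lt with rfl | hk
  · simp [orient, cw, walk_add_period]
  · exact (orient_walk_pos hv s hij hjk hk).le

theorem exists_walk_eq {n : ℕ} [NeZero n] (v : ZMod n → Plane) (s : ZMod n) (i : ℕ) (x : ZMod n) :
    ∃ m, i ≤ m ∧ m < i + n ∧ v x = walk v s m := by
  have := ZMod.val_lt (x - s - (i : ZMod n))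
  refine ⟨i + (x - s - (i : ZMod n)).val, by omega, by omega, ?_⟩
  simp [walk]

theorem edge_support {n : ℕ} {v : ZMod n → Plane} (hv : IsClockwiseConvexPolygon v)
    (s : ZMod n) (i : ℕ) :
    ∀ Y ∈ polygon v, 0 ≤ cw (walk v s (i + 1) - walk v s i) (Y - walk v s i) := by
  have : NeZero n := ⟨by have := hv.three_le; omega⟩
  apply polygon_subset_halfPlane
  intro x
  obtain ⟨m, h1, h2, e⟩ := exists_walk_eq v s i x
  rw [e]
  rcases h1.eq_or_lt with rfl | h1
  · simp [cw]
  · exact orient_walk_nonneg hv s (by omega) h1 (by omega)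

theorem edge_support' {n : ℕ} {v : ZMod n → Plane} (hv : IsClockwiseConvexPolygon v)
    (s : ZMod n) (i : ℕ) :
    ∀ Y ∈ polygon v, 0 ≤ cw (walk v s (i + 1) - walk v s i) (Y - walk v s (i + 1)) := by
  intro Y hY
  have h := edge_support hv s i Y hY
  simp only [cw, PiLp.sub_apply] at h ⊢
  linarith

theorem walk_mem_polygon {n : ℕ} (v : ZMod n → Plane) (s : ZMod n) (i : ℕ) :
    walk v s i ∈ polygon v :=
  subset_convexHull ℝ _ ⟨_, rfl⟩

/-! ### Cross product inequalities behind the two kinds of kill. -/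

/-- Algebraic core of the case in which the first unit is killed: the stable corner `X` lies beyond
the intersection point of the rays from `W` in direction `p` and from `K` in direction `-E`. -/
theorem killFst_core {B C X W K K₀ E p : Plane} {β : ℝ} (hβ : 0 ≤ β) (hW : W = B + β • E)
    (hpos : 0 < orient B C X) (hCx : 0 ≤ cw (C - K₀) (X - B)) (hBy : 0 ≤ cw E (X - C))
    (hBKC₀ : 0 < orient B K₀ C) (hEC : 0 < cw E (C - B))
    (hEK : 0 ≤ cw E (K - B)) (hBKC : 0 ≤ orient B K C) (hKp : 0 < cw (K - B) p)
    (hpw : 0 ≤ cw p (C - K₀)) (huw : 0 < cw (K - B) (C - K₀)) :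
    0 < cw E (C - K₀) ∧ 0 < cw E p ∧ 0 ≤ cw p (X - W) := by
  have hx : 0 < cw (C - B) (X - B) := hpos
  have hEx : 0 < cw E (X - B) := by
    have e : cw E (X - B) = cw E (X - C) + cw E (C - B) := by
      simp only [cw, PiLp.sub_apply]; ring
    rw [e]; positivity
  -- Here and below, a Plücker relation writes the unknown cross product, times a known positive
  -- one, as a sum of products of known sign.
  have hEw : 0 < cw E (C - K₀) := by
    have e : cw (C - B) (X - B) * cw E (C - K₀) =
        orient B K₀ C * cw E (X - B) + cw E (C - B) * cw (C - K₀) (X - B) := by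
      simp only [orient, cw, PiLp.sub_apply]; ring
    exact pos_of_mul_pos_right (by rw [e]; positivity) hx.le
  have hEp : 0 < cw E p := by
    have e : cw (K - B) (C - K₀) * cw E p =
        cw (K - B) p * cw E (C - K₀) + cw E (K - B) * cw p (C - K₀) := by
      simp only [cw, PiLp.sub_apply]; ring
    exact pos_of_mul_pos_right (by rw [e]; positivity) huw.le
  have hKX : 0 ≤ cw (K - B) (X - B) := by
    have e : cw E (C - B) * cw (K - B) (X - B) =
        cw E (K - B) * cw (C - B) (X - B) + cw E (X - B) * orient B K C := by
      simp only [orient, cw, PiLp.sub_apply]; ring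
    exact nonneg_of_mul_nonneg_right (by rw [e]; positivity) hEC
  have hpx : 0 ≤ cw p (X - B) := by
    have e : cw (K - B) (C - K₀) * cw p (X - B) =
        cw (K - B) p * cw (C - K₀) (X - B) + cw (K - B) (X - B) * cw p (C - K₀) := by
      simp only [cw, PiLp.sub_apply]; ring
    exact nonneg_of_mul_nonneg_right (by rw [e]; positivity) huw
  refine ⟨hEw, hEp, ?_⟩
  have e : cw p (X - W) = cw p (X - B) + β * cw E p := by
    rw [hW]
    simp only [cw, PiLp.sub_apply, PiLp.add_apply, PiLp.smul_apply, smul_eq_mul]; ring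
  rw [e]; positivity

theorem height_mul_eq (W K X E p : Plane) :
    cw (K - W) (X - W) * cw E p = cw (K - W) p * cw E (K - W) +
      cw (K - W) p * cw E (X - K) + cw E (K - W) * cw p (X - W) := by
  simp only [cw, PiLp.sub_apply]; ring

/-- Algebraic core of the case in which the second unit is killed and is a vertex. -/
theorem killSnd_vertex_core {A B X W K J E p : Plane} (hA : cw (K - B) (A - X) ≤ 0)
    (hAp : 0 ≤ cw p (A - K)) (hδ : 0 ≤ orient W B K) (hu'p : 0 < cw (K - B) p)
    (hup : 0 < cw (K - W) p) (hEp : 0 < cw E p) (hEu : 0 ≤ cw E (K - W))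
    (hxp : 0 ≤ cw (X - B) p) (hpos : 0 < orient B K X) (hd : 0 ≤ cw (X - K) (B - J))
    (hEd : 0 ≤ cw E (B - J)) (hJ : 0 < orient J B K) (hEB : 0 ≤ cw E (B - W)) :
    cw (K - W) (A - W) * cw E p ≤ cw E (K - W) * cw (K - W) p := by
  have h1 : 0 ≤ cw E (K - B) := by
    have e : cw (K - W) p * cw E (K - B) =
        cw E (K - W) * cw (K - B) p + orient W B K * cw E p := by
      simp only [orient, cw, PiLp.sub_apply]; ring
    exact nonneg_of_mul_nonneg_right (by rw [e]; positivity) hup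
  have h2 : cw E (X - K) ≤ 0 := by
    have e : orient J B K * (-cw E (X - K)) =
        cw E (K - B) * cw (X - K) (B - J) + orient B K X * cw E (B - J) := by
      simp only [orient, cw, PiLp.sub_apply]; ring
    have := nonneg_of_mul_nonneg_right (by rw [e]; positivity) hJ
    linarith
  -- With φ_W the height over `WK` scaled so that `p` has height one, the chain is φ_W(A) ≤ φ_B(A) ≤
  -- φ_B(X) ≤ `cw E (K - B) / cw E p` ≤ `cw E (K - W) / cw E p`, and the last term is the scaled
  -- height of the ray intersection.
  have h3 : orient B K X * cw E p ≤ cw E (K - B) * cw (K - B) p := by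
    have e : orient B K X * cw E p = cw (K - B) p * cw E (X - K) - cw E (K - B) * cw (X - B) p +
        cw E (K - B) * cw (K - B) p := by
      simp only [orient, cw, PiLp.sub_apply]; ring
    have := mul_nonneg hu'p.le (neg_nonneg.2 h2)
    have := mul_nonneg h1 hxp
    linarith
  have h4 : cw E (K - B) ≤ cw E (K - W) := by
    have e : cw E (K - W) = cw E (K - B) + cw E (B - W) := by
      simp only [cw, PiLp.sub_apply]; ring
    linarith
  have h5 : cw (K - W) (A - W) * cw (K - B) p ≤ cw (K - W) p * orient B K X := by
    have e : cw (K - W) (A - W) * cw (K - B) p = cw (K - W) p * cw (K - B) (A - X) +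
        cw (K - W) p * orient B K X - orient W B K * cw p (A - K) := by
      simp only [orient, cw, PiLp.sub_apply]; ring
    have := mul_nonneg hup.le (neg_nonneg.2 hA)
    have := mul_nonneg hδ hAp
    linarith
  refine le_of_mul_le_mul_right ?_ hu'p
  calc cw (K - W) (A - W) * cw E p * cw (K - B) p
      = cw (K - W) (A - W) * cw (K - B) p * cw E p := by ring
    _ ≤ cw (K - W) p * orient B K X * cw E p := by gcongr
    _ = cw (K - W) p * (orient B K X * cw E p) := by ring
    _ ≤ cw (K - W) p * (cw E (K - B) * cw (K - B) p) := by gcongr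
    _ ≤ cw (K - W) p * (cw E (K - W) * cw (K - B) p) := by gcongr
    _ = _ := by ring

/-- In a clockwise quadrilateral an affine function that is smaller at the third vertex than at the
second one and that is minimal at the first vertex among the others is not larger at the fourth
vertex than at the third one. -/
theorem quadrilateral_affine {W B C K E : Plane} (hWBK : 0 < orient W B K)
    (hWCK : 0 ≤ orient W C K) (hWBC : 0 ≤ orient W B C) (hBCK : 0 ≤ orient B C K)
    (hB : 0 ≤ cw E (B - W)) (hK : 0 ≤ cw E (K - W)) (hCK : cw E (C - W) < cw E (K - W)) :
    cw E (B - W) ≤ cw E (C - W) := by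
  by_contra! h
  have e : orient W B K * cw E (C - W) =
      orient W C K * cw E (B - W) + orient W B C * cw E (K - W) := by
    simp only [orient, cw, PiLp.sub_apply]; ring
  have e' : orient W B C + orient W C K = orient W B K + orient B C K := by
    simp only [orient, cw, PiLp.sub_apply]; ring
  -- The weights of B and K in `e` sum to at least `orient W B K`, because `C` is not on the same
  -- side of `BK` as `W`; so the value at `C` is at least the smaller of the values at `B` and `K`.
  have key : ∀ m : ℝ, 0 ≤ m → m ≤ cw E (B - W) → m ≤ cw E (K - W) → m ≤ cw E (C - W) := by
    intro m h0 h1 h2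
    refine le_of_mul_le_mul_left ?_ hWBK
    calc orient W B K * m ≤ (orient W B C + orient W C K) * m := by
          gcongr; linarith
      _ = orient W C K * m + orient W B C * m := by ring
      _ ≤ orient W B K * cw E (C - W) := by rw [e]; gcongr
  have := key (min (cw E (B - W)) (cw E (K - W))) (le_min hB hK) (min_le_left _ _)
    (min_le_right _ _)
  rcases min_choice (cw E (B - W)) (cw E (K - W)) with h' | h' <;> rw [h'] at this <;> linarith

/-- Algebraic core of the case in which the second unit is killed and is an edge. -/
theorem killSnd_edge_core {A B C X W K E p : Plane} {γ : ℝ} (hγ : 0 < γ) (hK : K = C + γ • p)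
    (hA : cw (C - B) (A - X) ≤ 0) (hAy : 0 ≤ cw (A - B) (X - C))
    (hAp : 0 ≤ cw p (A - C)) (hδ : 0 < orient W B K) (hu'p : 0 < cw (C - B) p)
    (hup : 0 < cw (K - W) p) (hEp : 0 < cw E p) (hEu : 0 ≤ cw E (K - W))
    (hxp : cw (X - B) p = 0) (hpos : 0 < orient B C X) (hd : 0 ≤ cw (X - C) (B - W))
    (hWBC : 0 < orient W B C) (hWCK : 0 ≤ orient W C K) (hEB : 0 ≤ cw E (B - W)) :
    cw (K - W) (A - W) * cw E p < cw E (K - W) * cw (K - W) p := by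
  have h1 : 0 ≤ cw E (C - B) := by
    have e : cw E (K - W) = cw E (C - W) + γ * cw E p := by
      rw [hK]
      simp only [cw, PiLp.sub_apply, PiLp.add_apply, PiLp.smul_apply, smul_eq_mul]; ring
    have e2 : orient B C K = γ * cw (C - B) p := by
      rw [hK]
      simp only [orient, cw, PiLp.sub_apply, PiLp.add_apply, PiLp.smul_apply, smul_eq_mul]; ring
    have e3 : cw E (C - B) = cw E (C - W) - cw E (B - W) := by
      simp only [cw, PiLp.sub_apply]; ring
    have := quadrilateral_affine hδ hWCK hWBC.le (by rw [e2]; positivity) hEB hEu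
      (by rw [e]; have := mul_pos hγ hEp; linarith)
    linarith
  have h2 : cw E (X - C) ≤ 0 := by
    have e : orient W B C * (-cw E (X - C)) =
        cw E (C - B) * cw (X - C) (B - W) + orient B C X * cw E (B - W) := by
      simp only [orient, cw, PiLp.sub_apply]; ring
    have := nonneg_of_mul_nonneg_right (by rw [e]; positivity) hWBC
    linarith
  have h3 : orient B C X * cw E p ≤ cw E (C - B) * cw (C - B) p := by
    have e : orient B C X * cw E p = cw (C - B) p * cw E (X - C) - cw E (C - B) * cw (X - B) p +
        cw E (C - B) * cw (C - B) p := by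
      simp only [orient, cw, PiLp.sub_apply]; ring
    have := mul_nonneg hu'p.le (neg_nonneg.2 h2)
    rw [hxp] at e
    linarith
  have h4 : cw E (C - B) ≤ cw E (K - W) - γ * cw E p := by
    have e : cw E (K - W) - γ * cw E p = cw E (C - B) + cw E (B - W) := by
      rw [hK]
      simp only [cw, PiLp.sub_apply, PiLp.add_apply, PiLp.smul_apply, smul_eq_mul]; ring
    linarith
  -- `A` is bounded by the parallel to `BC` through `X` and the parallel to `CX` through `B`. These
  -- meet in `B + X - C`, whose depth below the edge line is twice that of `B`, since `XB` is
  -- parallel to the edge.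
  have h5 : cw p (A - C) ≤ 2 * cw (C - B) p := by
    have e : orient B C X * cw p (A - C) = cw (C - B) p * cw (X - B) (A - C) -
        cw (C - B) (A - C) * cw (X - B) p := by
      simp only [orient, cw, PiLp.sub_apply]; ring
    have e2 : cw (X - B) (A - C) = cw (C - B) (A - X) + 2 * orient B C X
        - cw (A - B) (X - C) := by
      simp only [orient, cw, PiLp.sub_apply]; ring
    refine le_of_mul_le_mul_left ?_ hpos
    rw [e, hxp]
    have : cw (X - B) (A - C) ≤ 2 * orient B C X := by linarith
    have := mul_le_mul_of_nonneg_left this hu'p.le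
    linarith
  -- Moving the chord end from `C` to `K` costs `γ` in scaled height. The factor 2 in `h5` leaves
  -- exactly this `γ`, which `h4` provides.
  have h6 : cw (K - W) (A - W) * cw (C - B) p <
      cw (K - W) p * orient B C X + γ * cw (K - W) p * cw (C - B) p := by
    have e : cw (K - W) (A - W) * cw (C - B) p = cw (K - W) p * cw (C - B) (A - X) +
        cw (K - W) p * orient B C X - orient W B K * cw p (A - C) +
        γ * cw (K - W) p * cw p (A - C) - γ * cw (K - W) p * cw (C - B) p := by
      rw [hK]
      simp only [orient, cw, PiLp.sub_apply, PiLp.add_apply, PiLp.smul_apply, smul_eq_mul]; ring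
    have h7 := mul_nonneg hup.le (neg_nonneg.2 hA)
    have h8 : 0 < γ * cw (K - W) p := by positivity
    rcases hAp.eq_or_lt with h | h
    · rw [← h] at e
      have := mul_pos h8 hu'p
      linarith
    · have := mul_pos hδ h
      have := mul_le_mul_of_nonneg_left h5 h8.le
      linarith
  refine lt_of_mul_lt_mul_right ?_ hu'p.le
  calc cw (K - W) (A - W) * cw E p * cw (C - B) p
      = cw (K - W) (A - W) * cw (C - B) p * cw E p := by ring
    _ < (cw (K - W) p * orient B C X + γ * cw (K - W) p * cw (C - B) p) * cw E p := by gcongr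
    _ = cw (K - W) p * (orient B C X * cw E p + γ * cw (C - B) p * cw E p) := by ring
    _ ≤ cw (K - W) p * (cw E (C - B) * cw (C - B) p + γ * cw (C - B) p * cw E p) := by gcongr
    _ ≤ cw (K - W) p * ((cw E (K - W) - γ * cw E p) * cw (C - B) p +
        γ * cw (C - B) p * cw E p) := by gcongr
    _ = _ := by ring

/-! ### Heights of ray intersections. -/

/-- The height of the intersection point of two rays over the line through their origins. -/
theorem exists_ray_inter {W K E p : Plane} (hEp : 0 < cw E p) (hEu : 0 ≤ cw E (K - W))
    (hup : 0 ≤ cw (K - W) p) :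
    ∃ I ∈ ray W p ∩ ray K (-E), orient W K I * cw E p = cw E (K - W) * cw (K - W) p := by
  refine ⟨W + (cw E (K - W) / cw E p) • p, ⟨⟨_, by positivity, rfl⟩,
    ⟨cw (K - W) p / cw E p, by positivity, ?_⟩⟩, ?_⟩
  · have h := hEp.ne'
    ext i
    simp only [PiLp.add_apply, PiLp.smul_apply, PiLp.neg_apply, smul_eq_mul]
    field_simp
    fin_cases i <;> simp [cw] <;> ring
  · have e : orient W K (W + (cw E (K - W) / cw E p) • p) =
        (cw E (K - W) / cw E p) * cw (K - W) p := by
      simp only [orient, cw, PiLp.sub_apply, PiLp.add_apply, PiLp.smul_apply, smul_eq_mul]; ring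
    rw [e]
    field_simp

theorem height_of_mem_ray_inter {W K E p I : Plane} (hI : I ∈ ray W p ∩ ray K (-E))
    (hup : 0 < cw (K - W) p) : 0 < cw E p ∧ 0 ≤ orient W K I ∧
      orient W K I * cw E p = cw E (K - W) * cw (K - W) p := by
  obtain ⟨⟨α, hα, rfl⟩, ⟨β, hβ, h⟩⟩ := hI
  have h0 := congrArg (fun x : Plane => x 0) h
  have h1 := congrArg (fun x : Plane => x 1) h
  simp only [PiLp.add_apply, PiLp.smul_apply, PiLp.neg_apply, smul_eq_mul] at h0 h1
  have e1 : cw (K - W) p = β * cw E p := by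
    simp only [cw, PiLp.sub_apply]
    rw [show K 1 - W 1 = α * p 1 + β * E 1 by linarith,
      show K 0 - W 0 = α * p 0 + β * E 0 by linarith]
    ring
  have e2 : cw E (K - W) = α * cw E p := by
    simp only [cw, PiLp.sub_apply]
    rw [show K 1 - W 1 = α * p 1 + β * E 1 by linarith,
      show K 0 - W 0 = α * p 0 + β * E 0 by linarith]
    ring
  have e3 : orient W K (W + α • p) = α * cw (K - W) p := by
    simp only [orient, cw, PiLp.sub_apply, PiLp.add_apply, PiLp.smul_apply, smul_eq_mul]; ring
  have hEp : 0 < cw E p := by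
    rw [e1] at hup
    exact pos_of_mul_pos_right hup hβ
  exact ⟨hEp, by rw [e3]; positivity, by rw [e3, e2]; ring⟩

/-! ### Geometry of the kills along a convex walk. -/

/-- A clockwise walk of period `n` around the vertices of a convex region. -/
structure ConvexWalk (n : ℕ) (V : ℕ → Plane) (P : Set Plane) : Prop where
  mem : ∀ i, V i ∈ P
  pos : ∀ {i j k : ℕ}, i < j → j < k → k < i + n → 0 < orient (V i) (V j) (V k)
  nonneg : ∀ {i j k : ℕ}, i ≤ j → j ≤ k → k ≤ i + n → 0 ≤ orient (V i) (V j) (V k)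
  support : ∀ i, ∀ Y ∈ P, 0 ≤ cw (V (i + 1) - V i) (Y - V i)
  support' : ∀ i, ∀ Y ∈ P, 0 ≤ cw (V (i + 1) - V i) (Y - V (i + 1))
  hull : ∀ (i : ℕ) (d a : Plane), (∀ m, i ≤ m → m < i + n → 0 ≤ cw d (V m - a)) →
    ∀ Y ∈ P, 0 ≤ cw d (Y - a)

theorem convexWalk_walk {n : ℕ} {v : ZMod n → Plane} (hv : IsClockwiseConvexPolygon v)
    (s : ZMod n) : ConvexWalk n (walk v s) (polygon v) :=
  ⟨walk_mem_polygon v s, orient_walk_pos hv s, orient_walk_nonneg hv s, edge_support hv s,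
    edge_support' hv s, fun i d a h => by
      have : NeZero n := ⟨by have := hv.three_le; omega⟩
      refine polygon_subset_halfPlane fun x => ?_
      obtain ⟨m, h1, h2, e⟩ := exists_walk_eq v s i x
      exact e ▸ h m h1 h2⟩

theorem openSegment_param {a b B : Plane} (h : B ∈ openSegment ℝ a b) :
    ∃ β : ℝ, 0 < β ∧ β < 1 ∧ b = B + β • (b - a) ∧ B = a + (1 - β) • (b - a) := by
  obtain ⟨α, β, hα, hβ, hαβ, rfl⟩ := h
  obtain rfl : β = 1 - α := by linarith
  refine ⟨α, hα, by linarith, ?_, ?_⟩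
  · ext i
    simp only [PiLp.sub_apply, PiLp.add_apply, PiLp.smul_apply, smul_eq_mul]; ring
  · ext i
    simp only [PiLp.sub_apply, PiLp.add_apply, PiLp.smul_apply, smul_eq_mul]; ring

theorem cw_sub_of_mem_openSegment {a b B : Plane} (h : B ∈ openSegment ℝ a b) (Y : Plane) :
    cw (b - a) (Y - B) = cw (b - a) (Y - a) := by
  obtain ⟨β, -, -, -, rfl⟩ := openSegment_param h
  simp only [cw, PiLp.sub_apply, PiLp.add_apply, PiLp.smul_apply, smul_eq_mul]; ring

/-- By `height_mul_eq`, a point beyond both lines is higher than their intersection; `A` is at least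
as high as `X`. An infinite intersection point is excluded because `cw E p` is positive. -/
theorem not_distLE_of_beyond {W K E p A X : Plane} (hWK : W ≠ K) (hEp : 0 < cw E p)
    (hEu : 0 ≤ cw E (K - W)) (hup : 0 < cw (K - W) p) (hA : 0 ≤ orient W K A)
    (hmax : orient W K X ≤ orient W K A) (hpX : 0 ≤ cw p (X - W)) (hEX : 0 < cw E (X - K))
    (hc : ∀ I ∈ ray W p ∩ ray K (-E), lineDist W K A ≤ lineDist W K I) : False := by
  obtain ⟨I, hI, e⟩ := exists_ray_inter hEp hEu hup.le
  have hI0 := (height_of_mem_ray_inter hI hup).2.1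
  have h := (lineDist_le_iff hWK).1 (hc I hI)
  rw [abs_of_nonneg hA, abs_of_nonneg hI0] at h
  have e' := height_mul_eq W K X E p
  have h1 := mul_le_mul_of_nonneg_right (hmax.trans h) hEp.le
  have h2 := mul_pos hup hEX
  have h3 := mul_nonneg hEu hpX
  simp only [orient] at *
  linarith

theorem not_distLT_of_beyond {W K E p A X : Plane} (hWK : W ≠ K) (hEp : 0 < cw E p)
    (hEu : 0 ≤ cw E (K - W)) (hup : 0 < cw (K - W) p) (hA : 0 ≤ orient W K A)
    (hmax : orient W K X ≤ orient W K A) (hpX : 0 ≤ cw p (X - W)) (hEX : 0 ≤ cw E (X - K))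
    (hc : ∀ I ∈ ray W p ∩ ray K (-E), lineDist W K A < lineDist W K I) : False := by
  obtain ⟨I, hI, e⟩ := exists_ray_inter hEp hEu hup.le
  have hI0 := (height_of_mem_ray_inter hI hup).2.1
  have h := (lineDist_lt_iff hWK).1 (hc I hI)
  rw [abs_of_nonneg hA, abs_of_nonneg hI0] at h
  have e' := height_mul_eq W K X E p
  have h1 := mul_lt_mul_of_pos_right (hmax.trans_lt h) hEp
  have h2 := mul_nonneg hup.le hEX
  have h3 := mul_nonneg hEu hpX
  simp only [orient] at *
  linarith

theorem cw_sub_swap (x y a b : Plane) : cw (x - y) (a - b) = cw (y - x) (b - a) := by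
  simp only [cw, PiLp.sub_apply]; ring

namespace ConvexWalk

variable {n : ℕ} {V : ℕ → Plane} {P : Set Plane}

theorem ne (h : ConvexWalk n V P) (hn : 3 ≤ n) {j k : ℕ} (hjk : j < k) (hk : k < j + n) :
    V j ≠ V k := by
  rcases Nat.lt_or_ge (k + 1) (j + n) with h1 | h1
  · have := h.pos hjk (Nat.lt_succ_self k) h1
    intro e
    simp [e, orient, cw] at this
  · have := h.pos (Nat.lt_succ_self j) (by omega : j + 1 < k) hk
    intro e
    simp [e, orient, cw] at this

theorem killFst_vertex_vertex (h : ConvexWalk n V P) (hn : 3 ≤ n) {j k m : ℕ} (hjk : j < k)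
    (hkm : k < m) (hm : m < j + n) {A : Plane} (hA : 0 ≤ orient (V j) (V k) A)
    (hmax : ∀ Y ∈ P, orient (V j) (V k) Y ≤ orient (V j) (V k) A)
    (hc : ∀ I ∈ ray (V j) (V (k + 1) - V k) ∩ ray (V k) (-(V (j + 1) - V j)),
      lineDist (V j) (V k) A ≤ lineDist (V j) (V k) I)
    {X : Plane} (hX : Stable P X (V j) (V m)) : False := by
  have hup : 0 < cw (V k - V j) (V (k + 1) - V k) := by
    have := h.pos hjk (Nat.lt_succ_self k) (by omega)
    simp only [orient, cw, PiLp.sub_apply] at this ⊢; linarith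
  have hjkm := h.pos hjk hkm hm
  have hBy : 0 ≤ cw (V (j + 1) - V j) (X - V m) := by
    have := hX.le_B _ (h.mem (j + 1))
    simp only [cw] at this ⊢; linarith
  have hw : cw (V k - V j) (V m - V k) = orient (V j) (V k) (V m) := by
    simp only [orient, cw, PiLp.sub_apply]; ring
  obtain ⟨h1, h2, h3⟩ := killFst_core (B := V j) (C := V m) (X := X) (W := V j) (K := V k)
    (K₀ := V k) (E := V (j + 1) - V j) (p := V (k + 1) - V k) (β := 0) le_rfl (by simp) hX.pos
    (by have := hX.le_C _ (h.mem k); rw [cw_sub_swap] at this; simp only [cw] at this ⊢; linarith)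
    hBy hjkm (h.pos (Nat.lt_succ_self j) (by omega) hm) (h.support j _ (h.mem k)) hjkm.le hup
    (h.support k _ (h.mem m)) (by rw [hw]; exact hjkm)
  refine not_distLE_of_beyond (h.ne hn hjk (by omega)) h2 (h.support j _ (h.mem k)) hup hA
    (hmax X hX.mem_A) h3 ?_ hc
  simp only [cw, PiLp.sub_apply] at h1 hBy ⊢; linarith

theorem killFst_vertex_edge (h : ConvexWalk n V P) (hn : 3 ≤ n) {j i m : ℕ} (hji : j < i)
    (him : i < m) (hm : m < j + n) {A : Plane} (hA : 0 ≤ orient (V j) (V (i + 1)) A)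
    (hmax : ∀ Y ∈ P, orient (V j) (V (i + 1)) Y ≤ orient (V j) (V (i + 1)) A)
    (hc : ∀ I ∈ ray (V j) (V (i + 1) - V i) ∩ ray (V (i + 1)) (-(V (j + 1) - V j)),
      lineDist (V j) (V (i + 1)) A < lineDist (V j) (V (i + 1)) I)
    {X : Plane} (hX : Stable P X (V j) (V m)) : False := by
  have hjii := h.pos hji (Nat.lt_succ_self i) (by omega)
  have hup : 0 < cw (V (i + 1) - V j) (V (i + 1) - V i) := by
    simp only [orient, cw, PiLp.sub_apply] at hjii ⊢; linarith
  have hBy : 0 ≤ cw (V (j + 1) - V j) (X - V m) := by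
    have := hX.le_B _ (h.mem (j + 1))
    simp only [cw] at this ⊢; linarith
  have hjim := h.nonneg (by omega : j ≤ i + 1) (by omega : i + 1 ≤ m) hm.le
  have hw : 0 < cw (V (i + 1) - V j) (V m - V i) := by
    simp only [orient, cw, PiLp.sub_apply] at hjii hjim ⊢; linarith
  have key : ∀ q, j < q → q < m → 0 ≤ cw (V m - V q) (X - V j) := by
    intro q _ _
    have := hX.le_C _ (h.mem q)
    rw [cw_sub_swap] at this; simp only [cw] at this ⊢; linarith
  -- `C` may coincide with the terminal end `V (i + 1)`, so stability of `C` is tested at `V i`.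
  obtain ⟨h1, h2, h3⟩ := killFst_core (B := V j) (C := V m) (X := X) (W := V j) (K := V (i + 1))
    (K₀ := V i) (E := V (j + 1) - V j) (p := V (i + 1) - V i) (β := 0) le_rfl (by simp) hX.pos
    (key i hji him) hBy (h.pos hji him hm) (h.pos (Nat.lt_succ_self j) (by omega) hm)
    (h.support j _ (h.mem (i + 1))) hjim hup (h.support i _ (h.mem m)) hw
  -- Equality occurs when `m = i + 1`; this is why the criterion for J has to be strict.
  have hm' : 0 ≤ cw (V (j + 1) - V j) (V m - V (i + 1)) := by
    rcases (by omega : i + 1 = m ∨ i + 1 < m) with e | e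
    · simp [e, cw]
    · have hp := h.pos (by omega : j < i + 1) e hm
      refine (killFst_core (B := V j) (C := V m) (X := X) (W := V j) (K := V (i + 1))
        (K₀ := V (i + 1)) (E := V (j + 1) - V j) (p := V (i + 1) - V i) (β := 0) le_rfl (by simp)
        hX.pos (key _ (by omega) e) hBy hp (h.pos (Nat.lt_succ_self j) (by omega) hm)
        (h.support j _ (h.mem (i + 1))) hjim hup (h.support' i _ (h.mem m)) ?_).1.le
      simp only [orient, cw, PiLp.sub_apply] at hp ⊢; linarith
  refine not_distLT_of_beyond (h.ne hn (by omega) (by omega)) h2 (h.support j _ (h.mem _)) hup hA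
    (hmax X hX.mem_A) h3 ?_ hc
  simp only [cw, PiLp.sub_apply] at hm' hBy ⊢; linarith

/-- The edge giving the direction p starts at `V i`: `i = k` if the second unit is a vertex, and `i
+ 1 = k` if it is an edge. `C` lies strictly past `V k` in either case. -/
theorem killFst_edge (h : ConvexWalk n V P) (hn : 3 ≤ n) {l k i m : ℕ} (hlk : l + 1 < k)
    (hi : i = k ∨ i + 1 = k ∧ l + 1 < i) (hkm : k ≤ m) (hm : m + 1 < l + n) {A : Plane}
    (hA : 0 ≤ orient (V (l + 1)) (V k) A)
    (hmax : ∀ Y ∈ P, orient (V (l + 1)) (V k) Y ≤ orient (V (l + 1)) (V k) A)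
    (hc : ∀ I ∈ ray (V (l + 1)) (V (i + 1) - V i) ∩ ray (V k) (-(V (l + 1) - V l)),
      lineDist (V (l + 1)) (V k) A ≤ lineDist (V (l + 1)) (V k) I)
    {X B C : Plane} (hB : B ∈ openSegment ℝ (V l) (V (l + 1)))
    (hC : C ∈ openSegment ℝ (V m) (V (m + 1))) (hX : Stable P X B C) : False := by
  obtain ⟨β, hβ, -, hW, -⟩ := openSegment_param hB
  have hBkm : ∀ q, k ≤ q → q < l + n → 0 ≤ orient B (V k) (V q) := fun q h1 h2 =>
    orient_openSegment_nonneg hB (h.nonneg (by omega) h1 h2.le)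
      (h.nonneg (by omega) h1 (by omega))
  have hBKC : 0 < orient B (V k) C := by
    rw [← orient_rotate, ← orient_rotate]
    refine orient_openSegment_pos hC ?_ ?_
    · rw [orient_rotate, orient_rotate]; exact hBkm m hkm (by omega)
    · rw [orient_rotate, orient_rotate]
      exact orient_openSegment_pos' hB (h.pos (by omega) (by omega) hm)
        (h.nonneg (by omega) (by omega) (by omega))
  have hup : 0 < cw (V k - V (l + 1)) (V (i + 1) - V i) ∧ 0 < cw (V k - B) (V (i + 1) - V i) ∧
      0 ≤ cw (V (i + 1) - V i) (C - V k) := by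
    rcases hi with rfl | ⟨rfl, hi⟩
    · refine ⟨?_, ?_, h.support i _ hX.mem_C⟩
      · have := h.pos hlk (Nat.lt_succ_self i) (by omega)
        simp only [orient, cw, PiLp.sub_apply] at this ⊢; linarith
      · have : 0 < orient B (V i) (V (i + 1)) :=
          orient_openSegment_pos hB (h.nonneg (by omega) (by omega) (by omega))
            (h.pos hlk (Nat.lt_succ_self i) (by omega))
        simp only [orient, cw, PiLp.sub_apply] at this ⊢; linarith
    · refine ⟨?_, ?_, h.support' i _ hX.mem_C⟩
      · have := h.pos hi (Nat.lt_succ_self i) (by omega)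
        simp only [orient, cw, PiLp.sub_apply] at this ⊢; linarith
      · have : 0 < orient B (V i) (V (i + 1)) :=
          orient_openSegment_pos hB (h.nonneg (by omega) (by omega) (by omega))
            (h.pos hi (Nat.lt_succ_self i) (by omega))
        simp only [orient, cw, PiLp.sub_apply] at this ⊢; linarith
  obtain ⟨hup, hKp, hpw⟩ := hup
  have hBy : 0 ≤ cw (V (l + 1) - V l) (X - C) := by
    have h1 := hX.le_B _ (h.mem (l + 1))
    have e : cw (X - C) (V (l + 1) - B) = -(β * cw (V (l + 1) - V l) (X - C)) := by
      nth_rw 1 [hW]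
      simp only [cw, PiLp.sub_apply, PiLp.add_apply, PiLp.smul_apply, smul_eq_mul]; ring
    rw [e] at h1
    exact nonneg_of_mul_nonneg_right (by linarith) hβ
  have hEC : 0 < cw (V (l + 1) - V l) (C - B) := by
    rw [cw_sub_of_mem_openSegment hB]
    change 0 < orient (V l) (V (l + 1)) C
    rw [← orient_rotate, ← orient_rotate]
    refine orient_openSegment_pos hC ?_ ?_
    · rw [orient_rotate, orient_rotate]; exact h.nonneg (by omega) (by omega) (by omega)
    · rw [orient_rotate, orient_rotate]; exact h.pos (by omega) (by omega) hm
  obtain ⟨h1, h2, h3⟩ := killFst_core (K := V k) (K₀ := V k) hβ.le hW hX.pos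
    (by have := hX.le_C _ (h.mem k); rw [cw_sub_swap] at this; simp only [cw] at this ⊢; linarith)
    hBy hBKC hEC (by rw [cw_sub_of_mem_openSegment hB]; exact h.support l _ (h.mem k)) hBKC.le
    hKp hpw (by simp only [orient, cw, PiLp.sub_apply] at hBKC ⊢; linarith)
  refine not_distLE_of_beyond (h.ne hn hlk (by omega)) h2 (h.support' l _ (h.mem k)) hup hA
    (hmax X hX.mem_A) h3 ?_ hc
  simp only [cw, PiLp.sub_apply] at h1 hBy ⊢; linarith

/-- The edge E starts at W if the first unit is a vertex and ends at W if it is an edge; its line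
passes through W either way. -/
theorem support_cases (h : ConvexWalk n V P) {l j : ℕ} (hl : l = j ∨ l + 1 = j) :
    ∀ Y ∈ P, 0 ≤ cw (V (l + 1) - V l) (Y - V j) := by
  rcases hl with rfl | rfl
  · exact h.support l
  · exact h.support' l

theorem killSnd_vertex (h : ConvexWalk n V P) (hn : 3 ≤ n) {l j m k : ℕ}
    (hl : l = j ∨ l + 1 = j) (hlm : l < m) (hjm : j ≤ m) (hmk : m < k) (hk : k + 1 < j + n)
    {A : Plane} (hAP : A ∈ P) (hA : 0 ≤ orient (V j) (V k) A)
    (hc : ∃ I ∈ ray (V j) (V (k + 1) - V k) ∩ ray (V k) (-(V (l + 1) - V l)),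
      lineDist (V j) (V k) I < lineDist (V j) (V k) A)
    {X : Plane} (hX : Stable P X (V m) (V k)) : False := by
  obtain ⟨I, hI, hIA⟩ := hc
  have vec : ∀ q, orient (V q) (V k) (V (k + 1)) = cw (V k - V q) (V (k + 1) - V k) := by
    intro q
    simp only [orient, cw, PiLp.sub_apply]; ring
  have hup : 0 < cw (V k - V j) (V (k + 1) - V k) := by
    rw [← vec]; exact h.pos (by omega) (Nat.lt_succ_self k) hk
  obtain ⟨hEp, hI0, e⟩ := height_of_mem_ray_inter hI hup
  rw [lineDist_lt_iff (h.ne hn (by omega) (by omega)), abs_of_nonneg hI0, abs_of_nonneg hA] at hIA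
  have := killSnd_vertex_core (hX.le_A A hAP) (h.support k A hAP)
    (h.nonneg hjm hmk.le (by omega)) (by rw [← vec]; exact h.pos hmk (Nat.lt_succ_self k) (by omega))
    hup hEp (h.support_cases hl _ (h.mem k))
    (by
      have := hX.le_C _ (h.mem (k + 1))
      simp only [cw, PiLp.sub_apply] at this ⊢; linarith)
    hX.pos
    (J := V l)
    (by
      have := hX.le_B _ (h.mem l)
      simp only [cw, PiLp.sub_apply] at this ⊢; linarith)
    (h.support l _ (h.mem m)) (h.pos hlm hmk (by omega)) (h.support_cases hl _ (h.mem m))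
  have h1 := mul_lt_mul_of_pos_right hIA hEp
  simp only [orient] at *
  linarith

theorem killSnd_edge (h : ConvexWalk n V P) (hn : 3 ≤ n) {l j m i : ℕ}
    (hl : l = j ∨ l + 1 = j) (hjm : j ≤ m) (hmi : m + 1 ≤ i) (hi : i + 1 < j + n)
    {A : Plane} (hAP : A ∈ P) (hA : 0 ≤ orient (V j) (V (i + 1)) A)
    (hc : ∃ I ∈ ray (V j) (V (i + 1) - V i) ∩ ray (V (i + 1)) (-(V (l + 1) - V l)),
      lineDist (V j) (V (i + 1)) I ≤ lineDist (V j) (V (i + 1)) A)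
    {X B C : Plane} (hB : B ∈ openSegment ℝ (V m) (V (m + 1)))
    (hC : C ∈ openSegment ℝ (V i) (V (i + 1))) (hX : Stable P X B C) : False := by
  obtain ⟨I, hI, hIA⟩ := hc
  obtain ⟨γ, hγ, hγ1, hK, -⟩ := openSegment_param hC
  have hup : 0 < cw (V (i + 1) - V j) (V (i + 1) - V i) := by
    have := h.pos (by omega : j < i) (Nat.lt_succ_self i) hi
    simp only [orient, cw, PiLp.sub_apply] at this ⊢; linarith
  obtain ⟨hEp, hI0, e⟩ := height_of_mem_ray_inter hI hup
  rw [lineDist_le_iff (h.ne hn (by omega) (by omega)), abs_of_nonneg hI0, abs_of_nonneg hA] at hIA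
  have hWBK : 0 < orient (V j) B (V (i + 1)) := by
    rw [← orient_rotate]
    refine orient_openSegment_pos hB ?_ ?_
    · rw [orient_rotate]; exact h.nonneg hjm (by omega) hi.le
    · rw [orient_rotate]; exact h.pos (by omega) (by omega) hi
  have hWBi : 0 ≤ orient (V j) B (V i) := by
    rw [← orient_rotate]
    refine orient_openSegment_nonneg hB ?_ ?_
    · rw [orient_rotate]; exact h.nonneg hjm (by omega) (by omega)
    · rw [orient_rotate]; exact h.nonneg (by omega) (by omega) (by omega)
  have hu'p : 0 < cw (C - B) (V (i + 1) - V i) := by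
    have h1 : 0 < orient B (V i) (V (i + 1)) :=
      orient_openSegment_pos' hB (h.pos (by omega) (Nat.lt_succ_self i) (by omega))
        (h.nonneg (by omega) (by omega) (by omega))
    have h2 := cw_sub_of_mem_openSegment hC B
    simp only [orient, cw, PiLp.sub_apply] at h1 h2 ⊢; linarith
  -- `C` is interior to its edge, so its stability against both endpoints forces `XB` to be parallel
  -- to the edge.
  have hxp : cw (X - B) (V (i + 1) - V i) = 0 := by
    have h1 := hX.le_C _ (h.mem i)
    have h2 := hX.le_C _ (h.mem (i + 1))
    have e1 : cw (B - X) (V (i + 1) - C) = -(γ * cw (X - B) (V (i + 1) - V i)) := by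
      nth_rw 1 [hK]
      simp only [cw, PiLp.sub_apply, PiLp.add_apply, PiLp.smul_apply, smul_eq_mul]; ring
    have e2 : cw (B - X) (V i - C) = (1 - γ) * cw (X - B) (V (i + 1) - V i) := by
      have : cw (B - X) (V i - C) = cw (B - X) (V (i + 1) - C) +
          cw (X - B) (V (i + 1) - V i) := by
        simp only [cw, PiLp.sub_apply]; ring
      rw [this, e1]; ring
    rw [e2] at h1
    rw [e1] at h2
    refine le_antisymm ?_ (nonneg_of_mul_nonneg_right (by linarith) hγ)
    exact nonpos_of_mul_nonpos_right h1 (by linarith)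
  have hWBC : 0 < orient (V j) B C := by
    rw [← orient_rotate, ← orient_rotate]
    refine orient_openSegment_pos hC ?_ ?_
    · rw [orient_rotate, orient_rotate]; exact hWBi
    · rw [orient_rotate, orient_rotate]; exact hWBK
  have hWCK : 0 ≤ orient (V j) C (V (i + 1)) := by
    rw [← orient_rotate]
    refine orient_openSegment_nonneg hC ?_ ?_
    · rw [orient_rotate]; exact h.nonneg (by omega) (by omega) hi.le
    · rw [orient_rotate]; exact h.nonneg (by omega) le_rfl hi.le
  have := killSnd_edge_core hγ hK (hX.le_A A hAP)
    (by
      have := hX.le_B A hAP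
      simp only [cw] at this ⊢; linarith)
    (by rw [cw_sub_of_mem_openSegment hC]; exact h.support i A hAP) hWBK hu'p hup hEp
    (h.support_cases hl _ (h.mem _)) hxp hX.pos
    (by
      have := hX.le_B _ (h.mem j)
      simp only [cw, PiLp.sub_apply] at this ⊢; linarith)
    hWBC hWCK (h.support_cases hl _ hX.mem_B)
  have h1 := mul_le_mul_of_nonneg_right hIA hEp.le
  simp only [orient] at *
  linarith

end ConvexWalk

/-! ### Heights over a moving chord. -/

namespace ConvexWalk

variable {n : ℕ} {V : ℕ → Plane} {P : Set Plane}

/-- Heights over a chord are maximal where they stop increasing. -/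
theorem orient_le_of_peak (h : ConvexWalk n V P) {j k A : ℕ} (hjk : j < k) (hkA : k ≤ A)
    (hA : A < j + n)
    (hrise : ∀ i, k ≤ i → i < A → 0 ≤ cw (V k - V j) (V (i + 1) - V i))
    (hpeak : cw (V k - V j) (V (A + 1) - V A) ≤ 0) :
    ∀ Y ∈ P, orient (V j) (V k) Y ≤ orient (V j) (V k) (V A) := by
  have hA0 : 0 ≤ orient (V j) (V k) (V A) := h.nonneg hjk.le hkA hA.le
  have hlow : ∀ i d, k ≤ i → i + d = A → 0 ≤ cw (V k - V j) (V A - V i) := by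
    intro i d
    induction d generalizing i with
    | zero => rintro - rfl; simp [cw]
    | succ d ih =>
      intro hi hd
      have h1 := ih (i + 1) (by omega) (by omega)
      have h2 := hrise i hi (by omega)
      simp only [cw, PiLp.sub_apply] at h1 h2 ⊢; linarith
  have hvert : ∀ m, j ≤ m → m < j + n → 0 ≤ cw (V j - V k) (V m - V A) := by
    intro m h1 h2
    rcases Nat.lt_or_ge m k with h3 | h3
    · have := h.nonneg h1 h3.le (by omega)
      simp only [orient, cw, PiLp.sub_apply] at this hA0 ⊢; linarith
    rcases Nat.lt_or_ge A m with h4 | h4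
    · rcases hkA.eq_or_lt with rfl | hkA
      · have := h.pos hjk (Nat.lt_succ_self k) (by omega)
        simp only [orient, cw, PiLp.sub_apply] at this hpeak; linarith
      -- Beyond the peak, convexity at the non-rising edge after `V A` keeps all later vertices from
      -- being higher.
      · have e : orient (V k) (V A) (V (A + 1)) * cw (V j - V k) (V m - V A) =
            -(orient (V k) (V A) (V m) * cw (V k - V j) (V (A + 1) - V A)) +
            cw (V (A + 1) - V A) (V m - V A) * (orient (V j) (V k) (V A)) := by
          simp only [orient, cw, PiLp.sub_apply]; ring
        refine nonneg_of_mul_nonneg_right ?_ (h.pos hkA (Nat.lt_succ_self A) (by omega))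
        rw [e]
        have i1 := mul_nonneg (h.nonneg hkA.le h4.le (by omega)) (neg_nonneg.2 hpeak)
        have i2 := mul_nonneg (h.support A _ (h.mem m)) hA0
        linarith
    · have := hlow m (A - m) h3 (by omega)
      simp only [cw, PiLp.sub_apply] at this ⊢; linarith
  intro Y hY
  have := h.hull j _ _ hvert Y hY
  simp only [orient, cw, PiLp.sub_apply] at this ⊢; linarith

/-- The new chord is the old one plus the edge at `k`, and by convexity every later edge up to `A`
points to the right of both. With `rise_succ_fst`, this means `A` never has to move back. -/
theorem rise_succ_snd (h : ConvexWalk n V P) {j k A : ℕ} (hjk : j < k) (hA : A < j + n)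
    (hrise : ∀ i, k ≤ i → i < A → 0 ≤ cw (V k - V j) (V (i + 1) - V i)) :
    ∀ i, k + 1 ≤ i → i < A → 0 ≤ cw (V (k + 1) - V j) (V (i + 1) - V i) := by
  intro i h1 h2
  have hi := hrise i (by omega) h2
  have hk := hrise k le_rfl (by omega)
  have e : orient (V j) (V k) (V i) * cw (V (k + 1) - V k) (V (i + 1) - V i) =
      cw (V k - V j) (V (k + 1) - V k) * orient (V k) (V i) (V (i + 1)) +
      cw (V k - V j) (V (i + 1) - V i) * cw (V (k + 1) - V k) (V i - V k) := by
    simp only [orient, cw, PiLp.sub_apply]; ring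
  have i1 := h.nonneg (by omega : k ≤ i) (Nat.le_succ i) (by omega)
  have i2 := h.support k _ (h.mem i)
  have := nonneg_of_mul_nonneg_right (by rw [e]; positivity)
    (h.pos hjk (by omega : k < i) (by omega))
  simp only [cw, PiLp.sub_apply] at this hi ⊢; linarith

theorem rise_succ_fst (h : ConvexWalk n V P) {j k A : ℕ} (hjk : j + 1 < k) (hA : A < j + n)
    (hrise : ∀ i, k ≤ i → i < A → 0 ≤ cw (V k - V j) (V (i + 1) - V i)) :
    ∀ i, k ≤ i → i < A → 0 ≤ cw (V k - V (j + 1)) (V (i + 1) - V i) := by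
  intro i h1 h2
  have hi := hrise i h1 h2
  rcases h1.eq_or_lt with rfl | h1
  · have := h.nonneg hjk.le (Nat.le_succ k) (by omega)
    simp only [orient, cw, PiLp.sub_apply] at this ⊢; linarith
  have e : orient (V j) (V k) (V i) * cw (V k - V (j + 1)) (V (i + 1) - V i) =
      orient (V j) (V (j + 1)) (V k) * orient (V k) (V i) (V (i + 1)) +
      cw (V k - V j) (V (i + 1) - V i) * orient (V (j + 1)) (V k) (V i) := by
    simp only [orient, cw, PiLp.sub_apply]; ring
  have i1 := h.nonneg h1.le (Nat.le_succ i) (by omega)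
  have i2 := h.nonneg (Nat.le_succ j) hjk.le (by omega)
  have i3 := h.nonneg hjk.le h1.le (by omega)
  exact nonneg_of_mul_nonneg_right (by rw [e]; positivity) (h.pos (by omega) h1 (by omega))

/-- If the height fell along an edge before the apex, convexity would keep the apex below that
edge's start, against stability. This starts the invariant. -/
theorem rise_of_stable (h : ConvexWalk n V P) {j k A : ℕ} (hjk : j < k)
    (hA : A < j + n) (hst : Stable P (V A) (V j) (V k)) :
    ∀ i, k ≤ i → i < A → 0 ≤ cw (V k - V j) (V (i + 1) - V i) := by
  intro i h1 h2
  rcases h1.eq_or_lt with rfl | h1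
  · have := h.nonneg hjk.le (Nat.le_succ k) (by omega)
    simp only [orient, cw, PiLp.sub_apply] at this ⊢; linarith
  by_contra! hneg
  have e : orient (V k) (V i) (V (i + 1)) * cw (V k - V j) (V i - V A) =
      -(orient (V k) (V i) (V A) * cw (V k - V j) (V (i + 1) - V i)) +
      cw (V (i + 1) - V i) (V A - V i) * orient (V j) (V k) (V i) := by
    simp only [orient, cw, PiLp.sub_apply]; ring
  have i1 := mul_pos (h.pos h1 h2 (by omega)) (neg_pos.2 hneg)
  have i2 := mul_nonneg (h.support i _ (h.mem A)) (h.nonneg hjk.le h1.le (by omega))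
  have i3 := mul_nonneg (h.nonneg h1.le (Nat.le_succ i) (by omega))
    (neg_nonneg.2 (hst.le_A _ (h.mem i)))
  linarith

theorem lineDist_lt_succ_iff (h : ConvexWalk n V P) (hn : 3 ≤ n) {j k A : ℕ} (hjk : j < k)
    (hkA : k ≤ A) (hA : A < j + n) :
    lineDist (V j) (V k) (V A) < lineDist (V j) (V k) (V (A + 1)) ↔
      0 < cw (V k - V j) (V (A + 1) - V A) := by
  rw [lineDist_lt_iff (h.ne hn hjk (by omega)), abs_of_nonneg (h.nonneg hjk.le hkA hA.le),
    abs_of_nonneg (h.nonneg hjk.le (by omega) (by omega))]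
  simp only [orient, cw, PiLp.sub_apply]
  constructor <;> intro h <;> linarith

/-- A step to `V (j + n) = V j` would reach height zero, which is no rise; so the inner loop cannot
run past the start of the chord. -/
theorem succ_lt_of_rise (h : ConvexWalk n V P) {j k A : ℕ} (hjk : j < k)
    (hkA : k ≤ A) (hA : A < j + n) (hV : V (j + n) = V j)
    (hrise : 0 < cw (V k - V j) (V (A + 1) - V A)) : A + 1 < j + n := by
  by_contra! hcon
  have e : A + 1 = j + n := by omega
  rw [e, hV] at hrise
  have := h.nonneg hjk.le hkA hA.le
  simp only [orient, cw, PiLp.sub_apply] at this hrise; linarith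

theorem lineDist_pos (h : ConvexWalk n V P) (hn : 3 ≤ n) {j k A : ℕ} (hjk : j < k)
    (hkA : k < A) (hA : A < j + n) : 0 < lineDist (V j) (V k) (V A) := by
  have hne := h.ne hn hjk (by omega)
  rw [lineDist_eq hne]
  exact div_pos (abs_pos.2 (h.pos hjk hkA hA).ne') (norm_pos_iff.2 (sub_ne_zero.2 hne.symm))

end ConvexWalk

theorem lineDist_left (B C : Plane) : lineDist B C B = 0 :=
  Metric.infDist_zero_of_mem (left_mem_affineSpan_pair ℝ B C)

theorem lineDist_right (B C : Plane) : lineDist B C C = 0 :=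
  Metric.infDist_zero_of_mem (right_mem_affineSpan_pair ℝ B C)

/-! ### Units as offsets: even offsets are vertices, odd offsets edges. -/

/-- The unit reached after `a` steps from `v s`. -/
def unitAt {n : ℕ} (s : ZMod n) (a : ℕ) : PolyUnit n := PolyUnit.next^[a] (.vertex s)

theorem unitAt_succ {n : ℕ} (s : ZMod n) (a : ℕ) : unitAt s (a + 1) = (unitAt s a).next := by
  simp only [unitAt, Function.iterate_succ_apply']

theorem unitAt_two_mul {n : ℕ} (s : ZMod n) (i : ℕ) :
    unitAt s (2 * i) = .vertex (s + (i : ZMod n)) := by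
  induction i with
  | zero => simp [unitAt]
  | succ i ih =>
    rw [show 2 * (i + 1) = 2 * i + 1 + 1 by ring, unitAt_succ, unitAt_succ, ih]
    simp [PolyUnit.next, add_assoc]

theorem unitAt_two_mul_add_one {n : ℕ} (s : ZMod n) (i : ℕ) :
    unitAt s (2 * i + 1) = .edge (s + (i : ZMod n)) := by
  rw [unitAt_succ, unitAt_two_mul]; rfl

theorem points_unitAt_two_mul {n : ℕ} (v : ZMod n → Plane) (s : ZMod n) (i : ℕ) :
    (unitAt s (2 * i)).points v = {walk v s i} := by
  rw [unitAt_two_mul]; rfl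

theorem points_unitAt_two_mul_add_one {n : ℕ} (v : ZMod n → Plane) (s : ZMod n) (i : ℕ) :
    (unitAt s (2 * i + 1)).points v = openSegment ℝ (walk v s i) (walk v s (i + 1)) := by
  rw [unitAt_two_mul_add_one]
  simp [PolyUnit.points, walk, add_assoc]

theorem unitAt_add {n : ℕ} (s : ZMod n) (i p : ℕ) :
    PolyUnit.next^[p] (.vertex (s + (i : ZMod n))) = unitAt s (p + 2 * i) := by
  rw [unitAt, Function.iterate_add_apply]
  congr 1
  exact (unitAt_two_mul s i).symm

theorem unitAt_injective {n : ℕ} (s : ZMod n) {a b c : ℕ} (hca : c ≤ a) (hcb : c ≤ b)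
    (ha : a < c + 2 * n) (hb : b < c + 2 * n) (h : unitAt s a = unitAt s b) : a = b := by
  have key : ∀ i j : ℕ, s + (i : ZMod n) = s + (j : ZMod n) → ∃ k : ℤ, (i : ℤ) - j = n * k := by
    intro i j hij
    have h1 : ((i : ℤ) : ZMod n) = ((j : ℤ) : ZMod n) := by
      simpa using add_left_cancel hij
    obtain ⟨k, hk⟩ := (ZMod.intCast_eq_intCast_iff_dvd_sub _ _ _).1 h1
    exact ⟨-k, by linarith⟩
  have fin : ∀ i j : ℕ, s + (i : ZMod n) = s + (j : ZMod n) → (i : ℤ) - j < n →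
      (j : ℤ) - i < n → i = j := by
    intro i j hij h1 h2
    obtain ⟨k, hk⟩ := key i j hij
    have hn : (0 : ℤ) < n := by omega
    have k1 : k < 1 := by
      by_contra! hk1
      have := mul_le_mul_of_nonneg_left hk1 hn.le
      linarith
    have k2 : -1 < k := by
      by_contra! hk1
      have := mul_le_mul_of_nonneg_left hk1 hn.le
      linarith
    obtain rfl : k = 0 := by omega
    simp at hk
    omega
  rcases Nat.even_or_odd' a with ⟨i, rfl | rfl⟩ <;> rcases Nat.even_or_odd' b with ⟨j, rfl | rfl⟩ <;>
    simp only [unitAt_two_mul, unitAt_two_mul_add_one, PolyUnit.vertex.injEq, PolyUnit.edge.injEq,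
      reduceCtorEq] at h
  · rw [fin i j h (by omega) (by omega)]
  · rw [fin i j h (by omega) (by omega)]

theorem isVertexOrEdgePair_unitAt {n : ℕ} (s : ZMod n) (a b : ℕ) :
    IsVertexOrEdgePair (unitAt s a, unitAt s b) ↔ a % 2 = b % 2 := by
  rcases Nat.even_or_odd' a with ⟨i, rfl | rfl⟩ <;> rcases Nat.even_or_odd' b with ⟨j, rfl | rfl⟩ <;>
    simp only [unitAt_two_mul, unitAt_two_mul_add_one, IsVertexOrEdgePair] <;> simp

theorem termEnd_unitAt {n : ℕ} (s : ZMod n) (a : ℕ) :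
    (unitAt s a).termEnd = s + (((a + 1) / 2 : ℕ) : ZMod n) := by
  rcases Nat.even_or_odd' a with ⟨i, rfl | rfl⟩
  · rw [unitAt_two_mul, show (2 * i + 1) / 2 = i by omega]; rfl
  · rw [unitAt_two_mul_add_one, show (2 * i + 1 + 1) / 2 = i + 1 by omega]
    simp [PolyUnit.termEnd, add_assoc]

/-- The configuration with the given offsets from `v s`. -/
def configAt {n : ℕ} (s : ZMod n) (A a b : ℕ) : Config n :=
  ⟨s + (A : ZMod n), unitAt s a, unitAt s b⟩

theorem edgeDir_add {n : ℕ} (v : ZMod n → Plane) (s : ZMod n) (i : ℕ) :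
    edgeDir v (s + (i : ZMod n)) = walk v s (i + 1) - walk v s i := by
  simp [edgeDir, walk, add_assoc]

theorem edgeDir_add_succ {n : ℕ} (v : ZMod n → Plane) (s : ZMod n) (i : ℕ) :
    edgeDir v (s + ((i + 1 : ℕ) : ZMod n) - 1) = walk v s (i + 1) - walk v s i := by
  rw [← edgeDir_add]; congr 1; push_cast; ring

theorem whileGuard_configAt {n : ℕ} (v : ZMod n → Plane) (s : ZMod n) (A a b : ℕ) :
    whileGuard v (configAt s A a b) ↔
      lineDist (walk v s ((a + 1) / 2)) (walk v s ((b + 1) / 2)) (walk v s A) <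
        lineDist (walk v s ((a + 1) / 2)) (walk v s ((b + 1) / 2)) (walk v s (A + 1)) := by
  have e : s + (A : ZMod n) + 1 = s + ((A + 1 : ℕ) : ZMod n) := by push_cast; ring
  simp only [whileGuard, configAt, termEnd_unitAt, e]
  rfl

section Criterion

variable {n : ℕ} (v : ZMod n → Plane) (s : ZMod n) (A j k : ℕ)

theorem killFstCriterion_vertex_vertex :
    killFstCriterion v (configAt s A (2 * j) (2 * k)) ↔
      ∀ I ∈ ray (walk v s j) (walk v s (k + 1) - walk v s k) ∩
        ray (walk v s k) (-(walk v s (j + 1) - walk v s j)),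
      lineDist (walk v s j) (walk v s k) (walk v s A) ≤
        lineDist (walk v s j) (walk v s k) I := by
  simp only [killFstCriterion, configAt, unitAt_two_mul, PolyUnit.termEnd, DistLE, ptI, rayTwo,
    rayTwo', edgeDir_add]
  rfl

theorem killFstCriterion_edge_edge :
    killFstCriterion v (configAt s A (2 * j + 1) (2 * k + 1)) ↔
      ∀ I ∈ ray (walk v s (j + 1)) (walk v s (k + 1) - walk v s k) ∩
        ray (walk v s (k + 1)) (-(walk v s (j + 1) - walk v s j)),
      lineDist (walk v s (j + 1)) (walk v s (k + 1)) (walk v s A) ≤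
        lineDist (walk v s (j + 1)) (walk v s (k + 1)) I := by
  have e : ∀ i : ℕ, s + (i : ZMod n) + 1 = s + ((i + 1 : ℕ) : ZMod n) := by
    intro i; push_cast; ring
  simp only [killFstCriterion, configAt, unitAt_two_mul_add_one, PolyUnit.termEnd, DistLE, ptH,
    rayOne, rayOne', e, edgeDir_add_succ]
  rfl

theorem killFstCriterion_vertex_edge :
    killFstCriterion v (configAt s A (2 * j) (2 * k + 1)) ↔
      ∀ I ∈ ray (walk v s j) (walk v s (k + 1) - walk v s k) ∩
        ray (walk v s (k + 1)) (-(walk v s (j + 1) - walk v s j)),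
      lineDist (walk v s j) (walk v s (k + 1)) (walk v s A) <
        lineDist (walk v s j) (walk v s (k + 1)) I := by
  have e : ∀ i : ℕ, s + (i : ZMod n) + 1 = s + ((i + 1 : ℕ) : ZMod n) := by
    intro i; push_cast; ring
  simp only [killFstCriterion, configAt, unitAt_two_mul, unitAt_two_mul_add_one,
    PolyUnit.termEnd, DistLT, ptJ, rayOne, rayTwo', e, edgeDir_add_succ, edgeDir_add]
  rfl

theorem killFstCriterion_edge_vertex :
    killFstCriterion v (configAt s A (2 * j + 1) (2 * k)) ↔
      ∀ I ∈ ray (walk v s (j + 1)) (walk v s (k + 1) - walk v s k) ∩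
        ray (walk v s k) (-(walk v s (j + 1) - walk v s j)),
      lineDist (walk v s (j + 1)) (walk v s k) (walk v s A) ≤
        lineDist (walk v s (j + 1)) (walk v s k) I := by
  have e : ∀ i : ℕ, s + (i : ZMod n) + 1 = s + ((i + 1 : ℕ) : ZMod n) := by
    intro i; push_cast; ring
  simp only [killFstCriterion, configAt, unitAt_two_mul, unitAt_two_mul_add_one,
    PolyUnit.termEnd, DistLE, ptK, rayTwo, rayOne', e, edgeDir_add_succ, edgeDir_add]
  rfl

end Criterion

/-! ### Dead pairs and the invariant. -/

/-- No stable triangle has its second and third corner in the given units. -/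
def NoStable {n : ℕ} (v : ZMod n → Plane) (u w : PolyUnit n) : Prop :=
  ∀ X B C : Plane, Stable (polygon v) X B C → B ∈ u.points v → C ∈ w.points v → False

theorem NoStable.gDead {n : ℕ} {v : ZMod n → Plane} {u w : PolyUnit n} (h : NoStable v u w) :
    GDead v u w := by
  rintro ⟨A, B, C, hABC, hB, hC⟩
  exact h A B C hABC.1.stable hB hC

/-- The invariant of the algorithm, in terms of offsets from `v s`, where `T` and `R` are the
offsets of `v t` and `v r`. -/
structure Invariant {n : ℕ} (v : ZMod n → Plane) (s : ZMod n) (T R A a b : ℕ) : Prop where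
  le_T : a ≤ 2 * T
  T_le : 2 * T ≤ b
  le_R : b ≤ 2 * R
  -- The terminal ends have offsets `(a + 1) / 2` and `(b + 1) / 2`. Keeping them distinct excludes
  -- exactly (v_t, v_t) and (e_{t-1}, v_t).
  lt : (a + 1) / 2 < (b + 1) / 2
  R_le : R ≤ A
  A_lt : A < (a + 1) / 2 + n
  rise : ∀ i, (b + 1) / 2 ≤ i → i < A →
    0 ≤ cw (walk v s ((b + 1) / 2) - walk v s ((a + 1) / 2)) (walk v s (i + 1) - walk v s i)

section

variable {n : ℕ} {v : ZMod n → Plane} (hv : IsClockwiseConvexPolygon v) {s : ZMod n}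
  {T R A a b : ℕ} (hRn : R < n) (hI : Invariant v s T R A a b)
  (hg : ¬ whileGuard v (configAt s A a b))

include hv hI in
theorem Invariant.height_nonneg :
    0 ≤ orient (walk v s ((a + 1) / 2)) (walk v s ((b + 1) / 2)) (walk v s A) :=
  (convexWalk_walk hv s).nonneg hI.lt.le (by have := hI.le_R; have := hI.R_le; omega) hI.A_lt.le

include hv hI hg in
theorem Invariant.height_max : ∀ Y ∈ polygon v,
    orient (walk v s ((a + 1) / 2)) (walk v s ((b + 1) / 2)) Y ≤
      orient (walk v s ((a + 1) / 2)) (walk v s ((b + 1) / 2)) (walk v s A) := by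
  have h := convexWalk_walk hv s
  have hkA : (b + 1) / 2 ≤ A := by have := hI.le_R; have := hI.R_le; omega
  rw [whileGuard_configAt, h.lineDist_lt_succ_iff hv.three_le hI.lt hkA hI.A_lt, not_lt] at hg
  exact h.orient_le_of_peak hI.lt hkA hI.A_lt hI.rise hg

include hv hRn hI hg in
/-- If the first unit is killed, the later vertex or edge pairs of its row admit no stable
triangle. -/
theorem Invariant.noStable_of_killFst (hc : killFstCriterion v (configAt s A a b)) {c : ℕ}
    (hbc : b < c) (hcR : c ≤ 2 * R) (hpar : a % 2 = c % 2) :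
    NoStable v (unitAt s a) (unitAt s c) := by
  intro X B C hX hB hC
  have h := convexWalk_walk hv s
  have hn := hv.three_le
  have hA := hI.height_nonneg hv
  have hmax := hI.height_max hv hg
  obtain ⟨h1, h2, h3, h4, h5, h6, -⟩ := hI
  rcases Nat.even_or_odd' a with ⟨j, rfl | rfl⟩
  · obtain ⟨m, rfl⟩ : ∃ m, c = 2 * m := ⟨c / 2, by omega⟩
    rw [points_unitAt_two_mul, Set.mem_singleton_iff] at hB hC
    subst hB hC
    rw [show (2 * j + 1) / 2 = j by omega] at hA hmax h4
    rcases Nat.even_or_odd' b with ⟨k, rfl | rfl⟩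
    · rw [show (2 * k + 1) / 2 = k by omega] at hA hmax h4
      rw [killFstCriterion_vertex_vertex] at hc
      exact h.killFst_vertex_vertex hn h4 (by omega) (by omega) hA hmax hc hX
    · rw [show (2 * k + 1 + 1) / 2 = k + 1 by omega] at hA hmax h4
      rw [killFstCriterion_vertex_edge] at hc
      rcases (by omega : j < k ∨ j = k) with h7 | rfl
      · exact h.killFst_vertex_edge hn h7 (by omega) (by omega) hA hmax hc hX
      -- The unit pair is (v_j, e_j): the two rays overlap in the side and contain v_j, at distance
      -- 0, so the strict criterion fails.
      · have := hc (walk v s j) ⟨⟨0, le_rfl, by simp⟩, ⟨1, zero_le_one, by simp⟩⟩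
        rw [lineDist_left] at this
        exact this.not_ge Metric.infDist_nonneg
  · obtain ⟨m, rfl⟩ : ∃ m, c = 2 * m + 1 := ⟨c / 2, by omega⟩
    rw [points_unitAt_two_mul_add_one] at hB hC
    rw [show (2 * j + 1 + 1) / 2 = j + 1 by omega] at hA hmax h4
    rcases Nat.even_or_odd' b with ⟨k, rfl | rfl⟩
    · rw [show (2 * k + 1) / 2 = k by omega] at hA hmax h4
      rw [killFstCriterion_edge_vertex] at hc
      exact h.killFst_edge hn h4 (Or.inl rfl) (by omega) (by omega) hA hmax hc hB hC hX
    · rw [show (2 * k + 1 + 1) / 2 = k + 1 by omega] at hA hmax h4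
      rw [killFstCriterion_edge_edge] at hc
      rcases (by omega : j + 1 < k ∨ j + 1 = k) with h7 | rfl
      · exact h.killFst_edge hn h4 (Or.inr ⟨rfl, h7⟩) (by omega) (by omega) hA hmax hc hB hC hX
      -- For consecutive edges, the terminal end of the second one lies on both rays, at distance 0,
      -- while `A` has positive distance.
      · have := hc (walk v s (j + 1 + 1)) ⟨⟨1, zero_le_one, by simp⟩, ⟨0, le_rfl, by simp⟩⟩
        rw [lineDist_right] at this
        exact this.not_gt (h.lineDist_pos hn h4 (by omega) (by omega))

include hv hI in
/-- If the second unit is killed, the later vertex or edge pairs of its column admit no stable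
triangle. -/
theorem Invariant.noStable_of_killSnd (hc : ¬ killFstCriterion v (configAt s A a b)) {c : ℕ}
    (hac : a < c) (hcT : c ≤ 2 * T) (hpar : c % 2 = b % 2) :
    NoStable v (unitAt s c) (unitAt s b) := by
  intro X B C hX hB hC
  have h := convexWalk_walk hv s
  have hn := hv.three_le
  have hA := hI.height_nonneg hv
  obtain ⟨h1, h2, h3, h4, h5, h6, -⟩ := hI
  have hAP := walk_mem_polygon v s A
  have hne : ∀ {m k : ℕ}, B = walk v s m → C = walk v s k → m ≤ k → m < k := by
    rintro m k hB hC hmk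
    refine lt_of_le_of_ne hmk ?_
    rintro rfl
    exact ne_of_orient_pos hX.pos (hB.trans hC.symm)
  rcases Nat.even_or_odd' b with ⟨k, rfl | rfl⟩
  · obtain ⟨m, rfl⟩ : ∃ m, c = 2 * m := ⟨c / 2, by omega⟩
    rw [points_unitAt_two_mul, Set.mem_singleton_iff] at hB hC
    have hmk := hne hB hC (by omega)
    subst hB hC
    rw [show (2 * k + 1) / 2 = k by omega] at hA h4
    -- `A` is strictly farther than a point of the plane, so it is not v_k; hence v_{k+1} comes no
    -- later than `A` and is not yet the start of the chord.
    have hk : ∀ j I, lineDist (walk v s j) (walk v s k) I <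
        lineDist (walk v s j) (walk v s k) (walk v s A) → k < A := by
      intro j I hI
      refine lt_of_le_of_ne (by omega) ?_
      rintro rfl
      rw [lineDist_right] at hI
      exact hI.not_ge Metric.infDist_nonneg
    rcases Nat.even_or_odd' a with ⟨j, rfl | rfl⟩
    · rw [show (2 * j + 1) / 2 = j by omega] at hA h4 h6
      rw [killFstCriterion_vertex_vertex] at hc
      push Not at hc
      have := hk _ _ hc.choose_spec.2
      exact h.killSnd_vertex hn (Or.inl rfl) (by omega) (by omega) hmk (by omega) hAP hA hc hX
    · rw [show (2 * j + 1 + 1) / 2 = j + 1 by omega] at hA h4 h6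
      rw [killFstCriterion_edge_vertex] at hc
      push Not at hc
      have := hk _ _ hc.choose_spec.2
      exact h.killSnd_vertex hn (Or.inr rfl) (by omega) (by omega) hmk (by omega) hAP hA hc hX
  · obtain ⟨m, rfl⟩ : ∃ m, c = 2 * m + 1 := ⟨c / 2, by omega⟩
    rw [points_unitAt_two_mul_add_one] at hB hC
    rw [show (2 * k + 1 + 1) / 2 = k + 1 by omega] at hA h4
    rcases Nat.even_or_odd' a with ⟨j, rfl | rfl⟩
    · rw [show (2 * j + 1) / 2 = j by omega] at hA h4 h6
      rw [killFstCriterion_vertex_edge] at hc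
      push Not at hc
      exact h.killSnd_edge hn (Or.inl rfl) (by omega) (by omega) (by omega) hAP hA hc hB hC hX
    · rw [show (2 * j + 1 + 1) / 2 = j + 1 by omega] at hA h4 h6
      rw [killFstCriterion_edge_edge] at hc
      push Not at hc
      obtain ⟨I, hI, hIA⟩ := hc
      exact h.killSnd_edge hn (Or.inr rfl) (by omega) (by omega) (by omega) hAP hA
        ⟨I, hI, hIA.le⟩ hB hC hX

end

section

variable {n : ℕ} {v : ZMod n → Plane} (hv : IsClockwiseConvexPolygon v) {s : ZMod n}
  {T R A a b : ℕ} (hTR : T < R) (hRn : R < n)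
  (hst : Stable (polygon v) (walk v s R) (walk v s 0) (walk v s T))

include hv hTR hRn hst in
theorem invariant_init : Invariant v s T R R 0 (2 * T) := by
  have hT : 0 < T := by
    rcases Nat.eq_zero_or_pos T with rfl | h
    · exact absurd rfl (ne_of_orient_pos hst.pos)
    · exact h
  have e : (2 * T + 1) / 2 = T := by omega
  refine ⟨by omega, by omega, by omega, by omega, le_rfl, by omega, ?_⟩
  rw [e]
  exact (convexWalk_walk hv s).rise_of_stable hT (by omega) hst

include hst in
-- The given triangle with apex v_s occupies the final pair, which therefore can never be lost.
theorem not_noStable : ¬ NoStable v (unitAt s (2 * T)) (unitAt s (2 * R)) := by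
  intro h
  refine h _ _ _ hst.rotate ?_ ?_ <;> rw [points_unitAt_two_mul] <;> rfl

include hv in
theorem Invariant.advanceA (hI : Invariant v s T R A a b)
    (hg : whileGuard v (configAt s A a b)) : Invariant v s T R (A + 1) a b := by
  have h := convexWalk_walk hv s
  have hkA : (b + 1) / 2 ≤ A := by have := hI.le_R; have := hI.R_le; omega
  rw [whileGuard_configAt, h.lineDist_lt_succ_iff hv.three_le hI.lt hkA hI.A_lt] at hg
  have hlt := h.succ_lt_of_rise hI.lt hkA hI.A_lt (walk_add_period v s _) hg
  obtain ⟨h1, h2, h3, h4, h5, h6, h7⟩ := hI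
  refine ⟨h1, h2, h3, h4, by omega, hlt, fun i hi1 hi2 => ?_⟩
  rcases (by omega : i < A ∨ i = A) with h8 | rfl
  · exact h7 i hi1 h8
  · exact hg.le

include hv hTR hRn hst in
theorem Invariant.killFst (hI : Invariant v s T R A a b) (hg : ¬ whileGuard v (configAt s A a b))
    (hfin : ¬ (a = 2 * T ∧ b = 2 * R)) (hc : killFstCriterion v (configAt s A a b)) :
    Invariant v s T R A (a + 1) b := by
  have h := convexWalk_walk hv s
  have hn := hv.three_le
  -- Killing v_t as first unit would make the final pair, still to its right, dead.
  have haT : a < 2 * T := by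
    refine lt_of_le_of_ne hI.le_T ?_
    rintro rfl
    exact not_noStable hst (hI.noStable_of_killFst hv hRn hg hc (c := 2 * R)
      (lt_of_le_of_ne hI.le_R fun e => hfin ⟨rfl, e⟩) le_rfl (by omega))
  obtain ⟨h1, h2, h3, h4, h5, h6, h7⟩ := hI
  rcases Nat.even_or_odd' a with ⟨j, rfl | rfl⟩
  · rw [show (2 * j + 1) / 2 = j by omega] at h4 h6 h7
    -- Only (v_{t-1}, v_t) is critical. There v_{t-1} lies on both rays defining I, at distance 0,
    -- so the criterion fails.
    have hlt : j + 1 < (b + 1) / 2 := by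
      by_contra! hle
      obtain rfl : b = 2 * (j + 1) := by omega
      obtain rfl : T = j + 1 := by omega
      rw [killFstCriterion_vertex_vertex] at hc
      have := hc (walk v s j) ⟨⟨0, le_rfl, by simp⟩, ⟨1, zero_le_one, by simp⟩⟩
      rw [lineDist_left] at this
      exact this.not_gt (h.lineDist_pos hn (by omega) (by omega) (by omega))
    refine ⟨haT, h2, h3, ?_, h5, by omega, ?_⟩ <;>
      rw [show (2 * j + 1 + 1) / 2 = j + 1 by omega]
    · exact hlt
    · exact h.rise_succ_fst hlt h6 h7
  · have e : (2 * j + 1 + 1 + 1) / 2 = (2 * j + 1 + 1) / 2 := by omega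
    exact ⟨haT, h2, h3, e ▸ h4, h5, e ▸ h6, e ▸ h7⟩

include hv hst in
theorem Invariant.killSnd (hI : Invariant v s T R A a b)
    (hfin : ¬ (a = 2 * T ∧ b = 2 * R)) (hc : ¬ killFstCriterion v (configAt s A a b)) :
    Invariant v s T R A a (b + 1) := by
  have h := convexWalk_walk hv s
  have hbR : b < 2 * R := by
    refine lt_of_le_of_ne hI.le_R ?_
    rintro rfl
    exact not_noStable hst (hI.noStable_of_killSnd hv hc (c := 2 * T)
      (lt_of_le_of_ne hI.le_T fun e => hfin ⟨e, rfl⟩) le_rfl (by omega))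
  obtain ⟨h1, h2, h3, h4, h5, h6, h7⟩ := hI
  rcases Nat.even_or_odd' b with ⟨k, rfl | rfl⟩
  · rw [show (2 * k + 1) / 2 = k by omega] at h4 h7
    refine ⟨h1, by omega, hbR, ?_, h5, h6, ?_⟩ <;>
      rw [show (2 * k + 1 + 1) / 2 = k + 1 by omega]
    · omega
    · exact h.rise_succ_snd h4 h6 h7
  · have e : (2 * k + 1 + 1 + 1) / 2 = (2 * k + 1 + 1) / 2 := by omega
    exact ⟨h1, by omega, hbR, e ▸ h4, h5, h6, e ▸ h7⟩

end

/-! ### The process as a whole. -/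

/-- The effect of one elementary step on a configuration satisfying the invariant. -/
theorem Invariant.step {n : ℕ} {v : ZMod n → Plane} (hv : IsClockwiseConvexPolygon v)
    {s : ZMod n} {T R A a b : ℕ} (hTR : T < R) (hRn : R < n)
    (hst : Stable (polygon v) (walk v s R) (walk v s 0) (walk v s T))
    (hI : Invariant v s T R A a b) (hfin : ¬ (a = 2 * T ∧ b = 2 * R)) :
    (nextAction v (configAt s A a b) = .advanceA ∧
      RotateKill.step v (configAt s A a b) = configAt s (A + 1) a b ∧
      Invariant v s T R (A + 1) a b) ∨
    (nextAction v (configAt s A a b) = .killFst ∧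
      RotateKill.step v (configAt s A a b) = configAt s A (a + 1) b ∧
      Invariant v s T R A (a + 1) b ∧
      ∀ c, b < c → c ≤ 2 * R → a % 2 = c % 2 → NoStable v (unitAt s a) (unitAt s c)) ∨
    (nextAction v (configAt s A a b) = .killSnd ∧
      RotateKill.step v (configAt s A a b) = configAt s A a (b + 1) ∧
      Invariant v s T R A a (b + 1) ∧
      ∀ c, a < c → c ≤ 2 * T → c % 2 = b % 2 → NoStable v (unitAt s c) (unitAt s b)) := by
  by_cases hg : whileGuard v (configAt s A a b)
  · have e : nextAction v (configAt s A a b) = .advanceA := by rw [nextAction, if_pos hg]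
    refine Or.inl ⟨e, ?_, hI.advanceA hv hg⟩
    rw [RotateKill.step, e]
    simp [configAt, add_assoc]
  by_cases hc : killFstCriterion v (configAt s A a b)
  · have e : nextAction v (configAt s A a b) = .killFst := by
      rw [nextAction, if_neg hg, if_pos hc]
    refine Or.inr (Or.inl ⟨e, ?_, hI.killFst hv hTR hRn hst hg hfin hc,
      fun c h1 h2 h3 => hI.noStable_of_killFst hv hRn hg hc h1 h2 h3⟩)
    rw [RotateKill.step, e]
    simp [configAt, unitAt_succ]
  · have e : nextAction v (configAt s A a b) = .killSnd := by
      rw [nextAction, if_neg hg, if_neg hc]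
    refine Or.inr (Or.inr ⟨e, ?_, hI.killSnd hv hst hfin hc,
      fun c h1 h2 h3 => hI.noStable_of_killSnd hv hc h1 h2 h3⟩)
    rw [RotateKill.step, e]
    simp [configAt, unitAt_succ]

/-- After `m` steps without termination the invariant holds, and the pairs of the table that admit
a stable triangle have been visited or are still ahead. -/
theorem config_spec {n : ℕ} {v : ZMod n → Plane} (hv : IsClockwiseConvexPolygon v)
    {r s t : ZMod n} {T R : ℕ} (hTR : T < R) (hRn : R < n) (ht : t = s + (T : ZMod n))
    (hr : r = s + (R : ZMod n))
    (hst : Stable (polygon v) (walk v s R) (walk v s 0) (walk v s T)) (m : ℕ)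
    (hm : ∀ m' < m, pairAt v r s t m' ≠ (.vertex t, .vertex r)) :
    ∃ A a b, config v r s t m = configAt s A a b ∧ Invariant v s T R A a b ∧
      -- Every step raises exactly one of the three offsets by one; with the bounds of the invariant
      -- this forces termination.
      A + a + b = m + R + 2 * T ∧
      ∀ c d, c ≤ 2 * T → 2 * T ≤ d → d ≤ 2 * R → c % 2 = d % 2 →
        ¬ NoStable v (unitAt s c) (unitAt s d) →
          (a ≤ c ∧ b ≤ d) ∨ ∃ m' < m, pairAt v r s t m' = (unitAt s c, unitAt s d) := by
  induction m with
  | zero =>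
    refine ⟨R, 0, 2 * T, ?_, invariant_init hv hTR hRn hst, by omega,
      fun c d h1 h2 _ _ _ => Or.inl ⟨by omega, h2⟩⟩
    simp only [config, Function.iterate_zero, id, configAt, unitAt_two_mul, hr, ht]
    rfl
  | succ m ih =>
    obtain ⟨A, a, b, hcfg, hI, hsum, hprog⟩ := ih fun m' h => hm m' (by omega)
    have hpair : pairAt v r s t m = (unitAt s a, unitAt s b) := by
      rw [pairAt, hcfg]; rfl
    have hfin : ¬ (a = 2 * T ∧ b = 2 * R) := by
      rintro ⟨rfl, rfl⟩
      refine hm m (by omega) ?_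
      rw [hpair, unitAt_two_mul, unitAt_two_mul, ht, hr]
    have hnext : config v r s t (m + 1) = RotateKill.step v (configAt s A a b) := by
      rw [← hcfg, config, config, Function.iterate_succ_apply']
    have lift : ∀ {c d : ℕ}, ((∃ m' < m, pairAt v r s t m' = (unitAt s c, unitAt s d)) →
        ∃ m' < m + 1, pairAt v r s t m' = (unitAt s c, unitAt s d)) :=
      fun ⟨m', h1, h2⟩ => ⟨m', by omega, h2⟩
    rcases hI.step hv hTR hRn hst hfin with ⟨-, h1, h2⟩ | ⟨-, h1, h2, h3⟩ | ⟨-, h1, h2, h3⟩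
    · exact ⟨A + 1, a, b, hnext.trans h1, h2, by omega, fun c d k1 k2 k3 k4 k5 =>
        (hprog c d k1 k2 k3 k4 k5).imp_right lift⟩
    · refine ⟨A, a + 1, b, hnext.trans h1, h2, by omega, fun c d k1 k2 k3 k4 k5 => ?_⟩
      rcases hprog c d k1 k2 k3 k4 k5 with ⟨k6, k7⟩ | k6
      · rcases k6.eq_or_lt with rfl | k6
        · rcases k7.eq_or_lt with rfl | k7
          · exact Or.inr ⟨m, by omega, hpair⟩
          · exact absurd (h3 d k7 k3 k4) k5
        · exact Or.inl ⟨k6, k7⟩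
      · exact Or.inr (lift k6)
    · refine ⟨A, a, b + 1, hnext.trans h1, h2, by omega, fun c d k1 k2 k3 k4 k5 => ?_⟩
      rcases hprog c d k1 k2 k3 k4 k5 with ⟨k6, k7⟩ | k6
      · rcases k7.eq_or_lt with rfl | k7
        · rcases k6.eq_or_lt with rfl | k6
          · exact Or.inr ⟨m, by omega, hpair⟩
          · exact absurd (h3 c k6 k1 k4) k5
        · exact Or.inl ⟨k6, k7⟩
      · exact Or.inr (lift k6)

/-- The corners of a 3-stable triangle, as offsets from the second corner. -/
theorem exists_offsets {n : ℕ} {v : ZMod n → Plane} (hv : IsClockwiseConvexPolygon v)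
    {r s t : ZMod n} (hst : Stable (polygon v) (v r) (v s) (v t)) :
    ∃ T R : ℕ, T < R ∧ R < n ∧ t = s + (T : ZMod n) ∧ r = s + (R : ZMod n) ∧
      (t - s).val = T ∧ (r - t).val = R - T := by
  have : NeZero n := ⟨by have := hv.three_le; omega⟩
  have ht : t = s + (((t - s).val : ℕ) : ZMod n) := by simp
  have hr : r = s + (((r - s).val : ℕ) : ZMod n) := by simp
  have hT := ZMod.val_lt (t - s)
  have hR := ZMod.val_lt (r - s)
  -- In the other cyclic order convexity would give the triangle nonpositive orientation.
  have hTR : (t - s).val < (r - s).val := by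
    by_contra! hle
    have h1 := (convexWalk_walk hv s).nonneg (Nat.zero_le _) hle (by omega)
    have h2 := hst.pos
    simp only [walk, Nat.cast_zero, add_zero, ← ht, ← hr] at h1
    simp only [orient, cw] at h1 h2
    linarith
  refine ⟨_, _, hTR, hR, ht, hr, rfl, ?_⟩
  have e : r - t = (((r - s).val - (t - s).val : ℕ) : ZMod n) := by
    rw [Nat.cast_sub hTR.le]; simp
  rw [e, ZMod.val_natCast_of_lt (by omega)]

end RotateKill

open RotateKill in
theorem mainTheorem3 {n : ℕ} (v : ZMod n → Plane) (hv : IsClockwiseConvexPolygon v)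
    (r s t : ZMod n) (hrst : IsThreeStable v (v r) (v s) (v t)) :
    ∃ N : ℕ, StopsAt v r s t N ∧
      (∀ m < N, nextAction v (config v r s t m) = .killFst →
        ∀ w : PolyUnit n, ArcLT t r (config v r s t m).u₂ w →
          IsVertexOrEdgePair ((config v r s t m).u₁, w) →
            GDead v (config v r s t m).u₁ w) ∧
      (∀ m < N, nextAction v (config v r s t m) = .killSnd →
        ∀ w : PolyUnit n, ArcLT s t (config v r s t m).u₁ w →
          IsVertexOrEdgePair (w, (config v r s t m).u₂) →
            GDead v w (config v r s t m).u₂) ∧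
      (∀ m ≤ N, pairAt v r s t m ∈ table r s t ∧
        pairAt v r s t m ≠ (.vertex t, .vertex t) ∧
        pairAt v r s t m ≠ (.edge (t - 1), .vertex t)) ∧
      (∀ u₁ u₂ : PolyUnit n, (u₁, u₂) ∈ table r s t → IsVertexOrEdgePair (u₁, u₂) →
        ¬ GDead v u₁ u₂ → ∃ m ≤ N, pairAt v r s t m = (u₁, u₂)) := by
  classical
  obtain ⟨T, R, hTR, hRn, ht, hr, hTval, hRval⟩ := exists_offsets hv hrst.1.stable
  have hst : Stable (polygon v) (walk v s R) (walk v s 0) (walk v s T) := by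
    have := hrst.1.stable
    simpa [walk, ← ht, ← hr] using this
  have hT0 : 0 < T := by
    rcases Nat.eq_zero_or_pos T with rfl | h
    · exact absurd rfl (ne_of_orient_pos hst.pos)
    · exact h
  have spec := config_spec hv hTR hRn ht hr hst
  have inj : ∀ {a b : ℕ}, a ≤ 2 * R → b ≤ 2 * R → unitAt s a = unitAt s b → a = b :=
    fun ha hb h => unitAt_injective s (Nat.zero_le _) (Nat.zero_le _) (by omega) (by omega) h
  have hexists : ∃ N, pairAt v r s t N = (.vertex t, .vertex r) := by
    by_contra! hno
    -- The number of steps need not be sharp: the invariant gives `A + a + b < n + 3 * T + 2 * R`.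
    obtain ⟨A, a, b, -, hI, hsum, -⟩ := spec (n + 2 * R + 2 * T) fun m' _ => hno m'
    obtain ⟨h1, h2, h3, h4, h5, h6, -⟩ := hI
    omega
  have hmin : ∀ m < Nat.find hexists, pairAt v r s t m ≠ (.vertex t, .vertex r) :=
    fun m hm => Nat.find_min hexists hm
  have hpair : ∀ {m A a b}, config v r s t m = configAt s A a b →
      pairAt v r s t m = (unitAt s a, unitAt s b) := by
    intro m A a b h
    rw [pairAt, h]; rfl
  have hstep : ∀ m < Nat.find hexists, ∃ A a b, config v r s t m = configAt s A a b ∧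
      Invariant v s T R A a b ∧ ¬ (a = 2 * T ∧ b = 2 * R) := by
    intro m hm
    obtain ⟨A, a, b, hcfg, hI, -⟩ := spec m fun m' h => hmin m' (h.trans hm)
    refine ⟨A, a, b, hcfg, hI, ?_⟩
    rintro ⟨rfl, rfl⟩
    refine hmin m hm ?_
    rw [hpair hcfg, unitAt_two_mul, unitAt_two_mul, ht, hr]
  have hfst : ∀ p, PolyUnit.next^[p] (PolyUnit.vertex s) = unitAt s p := fun p => rfl
  have hsnd : ∀ p, PolyUnit.next^[p] (PolyUnit.vertex t) = unitAt s (p + 2 * T) := by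
    intro p
    rw [ht, unitAt_add]
  refine ⟨Nat.find hexists, ⟨Nat.find_spec hexists, hmin⟩, ?_, ?_, ?_, ?_⟩
  · rintro m hm hact w ⟨p, q, hpq, hq, hp, rfl⟩ hw
    obtain ⟨A, a, b, hcfg, hI, hfin⟩ := hstep m hm
    rw [hcfg] at hact hp hw ⊢
    rw [hRval] at hq
    rw [hsnd] at hp hw ⊢
    have hb : b = p + 2 * T := inj hI.le_R (by omega) hp
    rcases hI.step hv hTR hRn hst hfin with ⟨h0, -⟩ | ⟨-, -, -, h⟩ | ⟨h0, -⟩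
    · simp [hact] at h0
    · exact (h _ (by omega) (by omega) ((isVertexOrEdgePair_unitAt s _ _).1 hw)).gDead
    · simp [hact] at h0
  · rintro m hm hact w ⟨p, q, hpq, hq, hp, rfl⟩ hw
    obtain ⟨A, a, b, hcfg, hI, hfin⟩ := hstep m hm
    rw [hcfg] at hact hp hw ⊢
    rw [hTval] at hq
    rw [hfst] at hp hw ⊢
    have ha : a = p := inj (by have := hI.le_T; omega) (by omega) hp
    rcases hI.step hv hTR hRn hst hfin with ⟨h0, -⟩ | ⟨h0, -⟩ | ⟨-, -, -, h⟩
    · simp [hact] at h0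
    · simp [hact] at h0
    · exact (h _ (by omega) (by omega) ((isVertexOrEdgePair_unitAt s _ _).1 hw)).gDead
  · intro m hm
    obtain ⟨A, a, b, hcfg, hI, -⟩ := spec m fun m' h => hmin m' (by omega)
    rw [hpair hcfg]
    obtain ⟨h1, h2, h3, h4, h5, h6, -⟩ := hI
    have ha : a ≤ 2 * (t - s).val := by omega
    have hb : b - 2 * T ≤ 2 * (r - t).val := by omega
    refine ⟨⟨⟨a, ha, rfl⟩, ⟨b - 2 * T, hb, ?_⟩⟩, ?_, ?_⟩
    · rw [hsnd, Nat.sub_add_cancel h2]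
    · intro h
      rw [ht, ← unitAt_two_mul] at h
      have ha := inj (by omega) (by omega) (Prod.mk.inj h).1
      have hb := inj (by omega) (by omega) (Prod.mk.inj h).2
      omega
    · intro h
      have e : PolyUnit.edge (t - 1) = unitAt s (2 * (T - 1) + 1) := by
        rw [unitAt_two_mul_add_one, ht, Nat.cast_sub hT0]
        congr 1
        push_cast
        ring
      rw [e, ht, ← unitAt_two_mul] at h
      have ha := inj (by omega) (by omega) (Prod.mk.inj h).1
      have hb := inj (by omega) (by omega) (Prod.mk.inj h).2
      omega
  · rintro u₁ u₂ ⟨⟨p, hp, rfl⟩, ⟨q, hq, rfl⟩⟩ hpar hdead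
    rw [hTval] at hp
    rw [hRval] at hq
    rw [hfst, hsnd] at hpar hdead ⊢
    obtain ⟨A, a, b, hcfg, hI, -, hprog⟩ := spec _ hmin
    have hlast := Nat.find_spec hexists
    rw [hpair hcfg, ht, hr, ← unitAt_two_mul, ← unitAt_two_mul] at hlast
    have ha := inj (by have := hI.le_T; omega) (by omega) (Prod.mk.inj hlast).1
    have hb := inj hI.le_R le_rfl (Prod.mk.inj hlast).2
    rcases hprog p (q + 2 * T) (by omega) (by omega) (by omega)
      ((isVertexOrEdgePair_unitAt s _ _).1 hpar) fun h => hdead h.gDead with ⟨h1, h2⟩ | ⟨m, h1, h2⟩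
    -- A pair still ahead of the final position can only be the final pair itself.
    · refine ⟨_, le_rfl, ?_⟩
      rw [hpair hcfg]
      congr 2 <;> omega
    · exact ⟨m, h1.le, h2⟩
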